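/- Let $n_x,n_u,m\in\mathbb N$, $t_f>0$, and consider the switched system with regions $\mathcal R_1,\dots,\mathcal R_m\subset\mathbb R^{n_x}\times\mathbb R^{n_u}$, $\dot x(t)=F(x(t),u(t),t)$, where $F(x,u,t)=\sum_{i=1}^m \mathbb 1_{(x,u)\in\mathcal R_i}\,f_i(x,u,t)$, and the stage cost $L(x,u)=\sum_{i=1}^m\mathbb 1_{(x,u)\in\mathcal R_i}\,L_i(x,u)$. (State-dependent switching with regions $S_i\subset\mathbb R^{n_x}$ is the case $\mathcal R_i=S_i\times\mathbb R^{n_u}$.) Trajectories are absolutely continuous and satisfy the equation almost everywhere. Assume that $F$ is continuous in $t\in[0,t_f]$ and Lipschitz in $(x,u)$, $\|F(x,u,t)-F(y,v,t)\|\le M(\|x-y\|+\|u-v\|)$ for $t\in[0,t_f]$ with $M\ge0$, and that $L$ is Borel measurable and bounded on bounded sets. Let $\psi:\mathbb R^{n_x}\to\mathbb R$ be a terminal cost and let $$V(x,t)=\inf_{u}\Big\{\int_t^{t_f}L(x(s),u(s))\,ds+\psi(x(t_f))\Big\},\qquad t\in[0,t_f],$$ be the value function, the infimum being over all integrable controls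 $u$ on $[t,t_f]$ whose trajectory $x(\cdot)$ with $x(t)=x$ has integrable running cost. Assume that $V$ is finite and globally Lipschitz in the state: $|V(x,t)-V(y,t)|\le\gamma\|x-y\|$ for all $x,y$ and $t\in[0,t_f]$, with $\gamma\ge0$. Let $1\le p<\infty$, let $u\in L^p([0,t_f];\mathbb R^{n_u})$ be a control (for example an optimal one), and let $x$ be its trajectory with $x(0)=x_0$. Let $\mathcal{NN}_{n,k,w}$ be the class of maps $\mathbb R^n\to\mathbb R^k$ given by feedforward ReLU networks with identity output activation and an arbitrary positive number of hidden layers, each with $w$ neurons. The approximants are $\hat u(t)=\Phi(\hat x(t),t)$ and $\hat V=\Psi$ with $\Phi\in\mathcal{NN}_{n_x+1,\,n_u,\,n_x+n_u+2}$ and $\Psi\in\mathcal{NN}_{n_x+1,\,1,\,n_x+3}$, where $\hat x$ is a trajectory under the control $\hat u$, that is, of $\dot{\hat x}(t)=F(\hat x(t),\Phi(\hat x(t),t),t)$, with $\hat x(0)=x_0$. Put $\beta(t)=Me^{Mt}$ and $\|\beta\|_p=\big(\int_0^{t_f}\beta(t)^p\,dt\big)^{1/p}$. Below, $\|\cdot\|_1$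 and $\|\cdot\|_p$ of functions of time are the norms of $L^1(0,t_f)$ and $L^p(0,t_f)$. Then: 1. (Error bound.) For all such networks $\Phi,\Psi$, all such $\hat x$ and all $t\in[0,t_f]$, $$\|x(t)-\hat x(t)\|\le\beta(t)\int_0^t\|u-\hat u\|\,ds,$$ $$|V(x(t),t)-\hat V(\hat x(t),t)|\le\gamma\beta(t)\int_0^t\|u-\hat u\|\,ds+|V(\hat x(t),t)-\hat V(\hat x(t),t)|.$$ If moreover $\varepsilon\ge0$, $\|u-\hat u\|_{1}\le\varepsilon$ and $\|V(\hat x(\cdot),\cdot)-\hat V(\hat x(\cdot),\cdot)\|_{p}\le\varepsilon$, then $\|V(x(\cdot),\cdot)-\hat V(\hat x(\cdot),\cdot)\|_{p}\le(\gamma\|\beta\|_p+1)\,\varepsilon$. 2. (Existence of accurate networks.) For every $\varepsilon>0$ and every $r\in\mathbb R$ there are such networks $\Phi,\Psi$ with $\|V-\hat V\|_{L^p(\{\|y\|\le r\}\times[0,t_f])}\le\varepsilon$, for which a trajectory $\hat x$ exists on $[0,t_f]$, and for which every such $\hat x$ satisfies $\|u-\hat u\|_1\le\varepsilon$, $\|u-\hat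 u\|_p\le\varepsilon$, $\|V(\hat x(\cdot),\cdot)-\hat V(\hat x(\cdot),\cdot)\|_p\le\varepsilon$ and $$\|V(x(\cdot),\cdot)-\hat V(\hat x(\cdot),\cdot)\|_{p}\le\varepsilon'=(\gamma\|\beta\|_p+1)\,\varepsilon .$$ If in addition $V(y,\cdot)$ is continuous on $[0,t_f]$ for every $y$, the same networks also satisfy $|V(y,t)-\hat V(y,t)|\le\varepsilon$ whenever $\|y\|\le r$ and $t\in[0,t_f]$, and $|V(x(t),t)-\hat V(\hat x(t),t)|\le(\gamma\beta(t)+1)\,\varepsilon$ for every $t\in[0,t_f]$. -/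

import Mathlib

open MeasureTheory Set

noncomputable section

/-- The state space `ℝ^{n}` (or control space) with its Euclidean norm. -/
abbrev Vec (n : ℕ) : Type := EuclideanSpace ℝ (Fin n)

/-- The switched function `(x, u) ↦ ∑ i, 𝟙_{(x, u) ∈ R i} g i x u` built from pieces `g i` that are
active on the regions `R i`. Regions of the state space alone are the sets `S i ×ˢ univ`. -/
def switched {nx nu m : ℕ} {E : Type*} [AddCommMonoid E]
    (R : Fin m → Set (Vec nx × Vec nu)) (g : Fin m → Vec nx → Vec nu → E)
    (x : Vec nx) (u : Vec nu) : E :=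
  ∑ i, (R i).indicator (fun z => g i z.1 z.2) (x, u)

/-- The right-hand side `F (x, u, t) = ∑ i, 𝟙_{(x, u) ∈ R i} f i (x, u, t)` of the switched system. -/
def switchedField {nx nu m : ℕ} (R : Fin m → Set (Vec nx × Vec nu))
    (f : Fin m → Vec nx → Vec nu → ℝ → Vec nx) (x : Vec nx) (u : Vec nu) (t : ℝ) : Vec nx :=
  switched R (fun i x u => f i x u t) x u

/-- `x` is, on `[a, b]`, the absolutely continuous solution of `x' (s) = F (x (s), u (s), s)` a.e.,
`x (a) = x₀`, written as the equivalent integral equation (Carathéodory solution). -/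
def IsTrajectory {nx nu : ℕ} (F : Vec nx → Vec nu → ℝ → Vec nx) (a b : ℝ) (x₀ : Vec nx)
    (x : ℝ → Vec nx) (u : ℝ → Vec nu) : Prop :=
  IntervalIntegrable (fun s => F (x s) (u s) s) volume a b ∧
    ∀ t ∈ Icc a b, x t = x₀ + ∫ s in a..t, F (x s) (u s) s

/-- `u` is an integrable control on `[a, b]`, `x` is its state trajectory starting from `x₀` at time
`a`, and the running cost is integrable along the pair. -/
def IsAdmissible {nx nu : ℕ} (F : Vec nx → Vec nu → ℝ → Vec nx) (L : Vec nx → Vec nu → ℝ)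
    (a b : ℝ) (x₀ : Vec nx) (x : ℝ → Vec nx) (u : ℝ → Vec nu) : Prop :=
  IntervalIntegrable u volume a b ∧ IsTrajectory F a b x₀ x u ∧
    IntervalIntegrable (fun s => L (x s) (u s)) volume a b

/-- The cost `∫_t^{tf} L (x (s), u (s)) ds + ψ (x (tf))`. -/
def cost {nx nu : ℕ} (L : Vec nx → Vec nu → ℝ) (ψ : Vec nx → ℝ) (t tf : ℝ)
    (x : ℝ → Vec nx) (u : ℝ → Vec nu) : ℝ :=
  (∫ s in t..tf, L (x s) (u s)) + ψ (x tf)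

/-- `V` is the value function: for each `x` and each `t ∈ [0, tf]`, `V x t` is the finite infimum (the
minimum, if it is attained) of the cost over all controls on `[t, tf]`, from the state `x` at time
`t`. -/
def IsValueFunction {nx nu : ℕ} (F : Vec nx → Vec nu → ℝ → Vec nx) (L : Vec nx → Vec nu → ℝ)
    (ψ : Vec nx → ℝ) (tf : ℝ) (V : Vec nx → ℝ → ℝ) : Prop :=
  ∀ x₀ : Vec nx, ∀ t ∈ Icc 0 tf,
    IsGLB {J : ℝ | ∃ x u, IsAdmissible F L t tf x₀ x u ∧ J = cost L ψ t tf x u} (V x₀ t)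

/-- The rectified linear unit. -/
def relu (a : ℝ) : ℝ := max a 0

/-- The maps `ℝ^n → ℝ^k` computed by a positive number of fully connected hidden layers with `k`
neurons each and activation function `ρ`. -/
inductive HiddenLayers (ρ : ℝ → ℝ) (n k : ℕ) : ((Fin n → ℝ) → (Fin k → ℝ)) → Prop
  | first (W : Matrix (Fin k) (Fin n) ℝ) (b : Fin k → ℝ) :
      HiddenLayers ρ n k (fun z i => ρ (W.mulVec z i + b i))
  | next (W : Matrix (Fin k) (Fin k) ℝ) (b : Fin k → ℝ) (g : (Fin n → ℝ) → (Fin k → ℝ))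
      (hg : HiddenLayers ρ n k g) :
      HiddenLayers ρ n k (fun z i => ρ (W.mulVec (g z) i + b i))

/-- The class `NN_{n, m, k}^ρ` of functions `ℝ^n → ℝ^m` described by feedforward neural networks with
`n` input neurons, `m` output neurons with the identity activation, and arbitrarily many hidden
layers of `k` neurons each with activation function `ρ`. -/
def NN (ρ : ℝ → ℝ) (n m k : ℕ) : Set ((Fin n → ℝ) → (Fin m → ℝ)) :=
  {Φ | ∃ g, HiddenLayers ρ n k g ∧ ∃ (A : Matrix (Fin m) (Fin k) ℝ) (c : Fin m → ℝ),
    Φ = fun z => A.mulVec (g z) + c}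

/-- The value at `(x, t) ∈ ℝ^{nx} × ℝ` of a function of `nx + 1` variables, as a Euclidean vector. -/
def evalAt {nx m : ℕ} (Φ : (Fin (nx + 1) → ℝ) → (Fin m → ℝ)) (x : Vec nx) (t : ℝ) : Vec m :=
  WithLp.toLp 2 (Φ (Fin.snoc (α := fun _ => ℝ) (fun i => x i) t))

/-- The approximate value function `V̂ (x, t)` given by a network with one output. -/
def valueNet {nx : ℕ} (Ψ : (Fin (nx + 1) → ℝ) → (Fin 1 → ℝ)) (x : Vec nx) (t : ℝ) : ℝ :=
  evalAt Ψ x t 0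

/-- The `L^p` norm over `[0, tf]` of the function `β (t) = M exp (M t)`. -/
def betaNorm (M tf p : ℝ) : ℝ :=
  (∫ t in (0 : ℝ)..tf, (M * Real.exp (M * t)) ^ p) ^ (1 / p)

end

/-! The error bound is a stability estimate. Grönwall's inequality for the difference of two
trajectories gives the factor `M * exp (M * t)` (`IsTrajectory.norm_sub_le`); the Lipschitz bound on
`V` and the triangle inequality carry it over to the value, and Minkowski's inequality turns it into
the `L^p` bound.

For existence, the control network ignores the state. The feedback loop is then open: the control is
a continuous function of time, close to `u` in `L^p`, and a trajectory exists because the dynamics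
are globally Lipschitz. All such trajectories lie in a ball known before the value network is
chosen.

The value network must be accurate along a trajectory, a null set of space-time when `nx > 0`, so an
`L^p` bound on space-time is not enough; the error has to be uniform in the state and `L^p` only in
time. Steering with the zero control in the dynamic programming inequality shows that `V y t + C *
t` is monotone in `t`. Hence `V` is measurable in time, and `t ↦ V(·, t)` is an `L^p` curve in the
continuous functions on a ball. A continuous curve approximates it, and a network approximates that
curve uniformly (`exists_valueNet_approx`).

Both networks come from universal approximation at width `d + m + 1` (`exists_NN_approx`):
Stone–Weierstrass yields a sum of ridge functions, and a deep narrow network adds up its terms one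
layer at a time. -/

/-! ### Density of shallow ReLU networks -/

theorem continuous_relu : Continuous relu := continuous_id.max continuous_const

/-- The ridge function `x ↦ relu (w ⬝ᵥ x + b)`. -/
def ridge {n : ℕ} (w : Fin n → ℝ) (b : ℝ) : C(Fin n → ℝ, ℝ) :=
  ⟨fun x => relu (w ⬝ᵥ x + b), continuous_relu.comp (by fun_prop)⟩

/-- The linear span of the ridge functions: shallow networks with one output. -/
def ridgeSpan (n : ℕ) : Submodule ℝ C(Fin n → ℝ, ℝ) :=
  Submodule.span ℝ (range fun q : (Fin n → ℝ) × ℝ => ridge q.1 q.2)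

theorem ridge_mem_ridgeSpan {n : ℕ} (w : Fin n → ℝ) (b : ℝ) : ridge w b ∈ ridgeSpan n :=
  Submodule.subset_span ⟨(w, b), rfl⟩

/-- Piecewise linear interpolation of a function of `w ⬝ᵥ x` on `[A, A + N h]`. -/
theorem exists_interpolation_mem_ridgeSpan {n : ℕ} (w : Fin n → ℝ) (g : ℝ → ℝ) {A B h δ : ℝ}
    (hh : 0 < h)
    (hg : ∀ y ∈ Icc A B, ∀ z ∈ Icc A B, |y - z| ≤ h → |g y - g z| ≤ δ) (N : ℕ)
    (hN : A + N * h ≤ B) :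
    ∃ P ∈ ridgeSpan n, ∀ x, (A + N * h ≤ w ⬝ᵥ x → P x = g (A + N * h)) ∧
      (w ⬝ᵥ x ∈ Icc A (A + N * h) → |g (w ⬝ᵥ x) - P x| ≤ 2 * δ) := by
  induction N with
  | zero =>
    -- Constants are available because `ridge 0 1` is identically `1`.
    refine ⟨g A • ridge 0 1, Submodule.smul_mem _ _ (ridge_mem_ridgeSpan _ _), fun x => ?_⟩
    have h1 : (g A • ridge (0 : Fin n → ℝ) 1) x = g A := by simp [ridge, relu]
    rw [h1]
    refine ⟨fun _ => by simp, fun hx => ?_⟩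
    simp only [Nat.cast_zero, zero_mul, add_zero, Icc_self, mem_singleton_iff] at hx hN
    have := hg A ⟨le_rfl, hN⟩ A ⟨le_rfl, hN⟩ (by simp [hh.le])
    rw [hx]
    have h2 := (abs_nonneg _).trans this
    simpa using h2
  | succ N ih =>
    push_cast at hN ⊢
    have hNh : 0 ≤ N * h := by positivity
    obtain ⟨P, hP, hPx⟩ := ih (by linarith)
    set s := A + N * h with hs
    have hs' : A + (N + 1) * h = s + h := by rw [hs]; ring
    rw [hs'] at hN ⊢
    -- The difference of the two ridges is a ramp: `0` before `s`, `h` after `s + h`. It leaves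
    -- earlier cells untouched and restores the invariant that the interpolant is constant beyond
    -- the last node.
    refine ⟨P + ((g (s + h) - g s) / h) • (ridge w (-s) - ridge w (-(s + h))),
      add_mem hP (Submodule.smul_mem _ _ (sub_mem (ridge_mem_ridgeSpan _ _)
        (ridge_mem_ridgeSpan _ _))), fun x => ?_⟩
    obtain ⟨h1, h2⟩ := hPx x
    simp only [ContinuousMap.add_apply, ContinuousMap.smul_apply, ContinuousMap.sub_apply, ridge,
      ContinuousMap.coe_mk, smul_eq_mul]
    generalize w ⬝ᵥ x = z at *
    constructor
    · intro hz
      rw [h1 (by linarith), relu, relu, max_eq_left (by linarith), max_eq_left (by linarith)]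
      field_simp
      ring
    · intro hz
      have e1 : relu (z + -(s + h)) = 0 := max_eq_right (by linarith [hz.2])
      rw [e1]
      rcases le_total z s with hzs | hzs
      · have e2 : relu (z + -s) = 0 := max_eq_right (by linarith)
        rw [e2]
        simpa using h2 ⟨hz.1, hzs⟩
      · have e2 : relu (z + -s) = z - s := by rw [relu, max_eq_left (by linarith)]; ring
        rw [e2, h1 hzs]
        -- On the new cell the error is an increment of `g` minus a fraction of another, each at
        -- most `δ`; hence `2 * δ`.
        have d1 := hg z ⟨hz.1, by linarith [hz.2]⟩ s ⟨by linarith, by linarith⟩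
          (by rw [abs_le]; constructor <;> linarith [hz.2])
        have d2 := hg (s + h) ⟨by linarith, hN⟩ s ⟨by linarith, by linarith⟩
          (by rw [abs_le]; constructor <;> linarith [hz.2])
        have e3 : g z - (g s + (g (s + h) - g s) / h * (z - s - 0)) =
            (g z - g s) - (g (s + h) - g s) * ((z - s) / h) := by
          field_simp
          ring
        have d3 : |(z - s) / h| ≤ 1 := by
          rw [abs_of_nonneg (div_nonneg (by linarith) hh.le), div_le_one hh]
          linarith [hz.2]
        rw [e3]
        refine (abs_sub _ _).trans ?_
        rw [abs_mul]
        nlinarith [abs_nonneg (g (s + h) - g s)]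

/-- A continuous function of `w ⬝ᵥ x` is approximated by shallow networks where `w ⬝ᵥ x` is
bounded. -/
theorem exists_ridgeSpan_approx_comp_dotProduct {n : ℕ} (w : Fin n → ℝ) {g : ℝ → ℝ}
    (hg : Continuous g) (c : ℝ) {δ : ℝ} (hδ : 0 < δ) :
    ∃ P ∈ ridgeSpan n, ∀ x, |w ⬝ᵥ x| ≤ c → |g (w ⬝ᵥ x) - P x| ≤ δ := by
  rcases lt_or_ge c 0 with hc | hc
  · exact ⟨0, zero_mem _, fun x hx => absurd (abs_nonneg (w ⬝ᵥ x)) (by linarith)⟩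
  -- The interval is widened from `c` to `c + 1` so that the mesh is positive even when `c = 0`.
  have hu := (isCompact_Icc (a := -(c + 1)) (b := c + 1)).uniformContinuousOn_of_continuous
    hg.continuousOn
  rw [Metric.uniformContinuousOn_iff_le] at hu
  obtain ⟨η, hη, hu⟩ := hu (δ / 2) (by positivity)
  obtain ⟨N, hN⟩ := exists_nat_gt (2 * (c + 1) / η)
  have hNpos : (0 : ℝ) < N := lt_of_le_of_lt (by positivity) hN
  obtain ⟨P, hP, hPx⟩ := exists_interpolation_mem_ridgeSpan w g (A := -(c + 1)) (B := c + 1)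
    (h := 2 * (c + 1) / N) (δ := δ / 2) (by positivity)
    (fun y hy z hz hyz => hu y hy z hz (hyz.trans (by
      rw [div_lt_iff₀ hη] at hN
      rw [div_le_iff₀ hNpos]
      linarith))) N (by field_simp; linarith)
  refine ⟨P, hP, fun x hx => ?_⟩
  have := (hPx x).2 (by
    rw [abs_le] at hx
    constructor
    · linarith
    · field_simp
      linarith)
  linarith

/-- Shallow ReLU networks are dense in the continuous functions on a compact set. -/
theorem exists_ridgeSpan_approx {n : ℕ} {K : Set (Fin n → ℝ)} (hK : IsCompact K)
    {G : (Fin n → ℝ) → ℝ} (hG : ContinuousOn G K) {δ : ℝ} (hδ : 0 < δ) :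
    ∃ P ∈ ridgeSpan n, ∀ x ∈ K, |G x - P x| ≤ δ := by
  have : CompactSpace K := isCompact_iff_compactSpace.1 hK
  let res : C(Fin n → ℝ, ℝ) →ₗ[ℝ] C(K, ℝ) :=
    (ContinuousMap.compRightAlgHom ℝ ℝ (⟨Subtype.val, continuous_subtype_val⟩ :
      C(K, Fin n → ℝ))).toLinearMap
  have hres : ∀ (P : C(Fin n → ℝ, ℝ)) (x : K), res P x = P x := fun _ _ => rfl
  let S : Submodule ℝ C(K, ℝ) := (ridgeSpan n).map res
  -- Ridge functions are not closed under products, but the exponentials `exp (w ⬝ᵥ x)` are. Their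
  -- span is therefore the algebra they generate, and it lies in the closure of `S` as soon as each
  -- exponential does.
  let E : Submonoid C(K, ℝ) :=
    { carrier := range fun w : Fin n → ℝ => (⟨fun x => Real.exp (w ⬝ᵥ x.1), by fun_prop⟩ : C(K, ℝ))
      one_mem' := ⟨0, by ext; simp⟩
      mul_mem' := by
        rintro _ _ ⟨v, rfl⟩ ⟨w, rfl⟩
        exact ⟨v + w, by ext; simp [Real.exp_add]⟩ }
  have hE : (E : Set C(K, ℝ)) ⊆ S.topologicalClosure := by
    rintro _ ⟨w, rfl⟩
    obtain ⟨c, hc⟩ := hK.exists_bound_of_continuousOn (f := fun x => w ⬝ᵥ x) (by fun_prop)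
    rw [SetLike.mem_coe, Submodule.topologicalClosure, ← SetLike.mem_coe]
    refine Metric.mem_closure_iff.2 fun ε hε => ?_
    obtain ⟨P, hP, hPx⟩ := exists_ridgeSpan_approx_comp_dotProduct w Real.continuous_exp c
      (half_pos hε)
    refine ⟨res P, ⟨P, hP, rfl⟩, lt_of_le_of_lt ?_ (half_lt_self hε)⟩
    refine (ContinuousMap.dist_le (half_pos hε).le).2 fun x => ?_
    rw [Real.dist_eq, hres]
    exact hPx x (hc x x.2)
  have hA : (Algebra.adjoin ℝ (E : Set C(K, ℝ))).toSubmodule ≤ S.topologicalClosure := by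
    rw [Algebra.adjoin_eq_span, Submonoid.closure_eq]
    exact Submodule.span_le.2 hE
  have hsep : (Algebra.adjoin ℝ (E : Set C(K, ℝ))).SeparatesPoints := by
    intro x y hxy
    have : (x : Fin n → ℝ) ≠ y := fun h => hxy (Subtype.ext h)
    obtain ⟨i, hi⟩ := Function.ne_iff.1 this
    refine ⟨_, ⟨_, Algebra.subset_adjoin ⟨Pi.single i 1, rfl⟩, rfl⟩, ?_⟩
    simpa using hi
  have htop := ContinuousMap.subalgebra_topologicalClosure_eq_top_of_separatesPoints _ hsep
  have hmem : (⟨K.domRestrict G, hG.domRestrict⟩ : C(K, ℝ)) ∈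
      (Algebra.adjoin ℝ (E : Set C(K, ℝ))).topologicalClosure := by
    rw [htop]
    trivial
  have hmem' : (⟨K.domRestrict G, hG.domRestrict⟩ : C(K, ℝ)) ∈ closure (S : Set C(K, ℝ)) :=
    closure_minimal (fun φ hφ => hA hφ) isClosed_closure hmem
  obtain ⟨_, ⟨P, hP, rfl⟩, hd⟩ := Metric.mem_closure_iff.1 hmem' δ hδ
  refine ⟨P, hP, fun x hx => ?_⟩
  have := (ContinuousMap.dist_apply_le_dist (⟨x, hx⟩ : K)).trans hd.le
  rwa [Real.dist_eq] at this

/-! ### Deep narrow networks -/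

/-- The linear map is absorbed into the first weight matrix. With `P` selecting the last coordinate,
a network in time becomes one in state and time at no cost in width. -/
theorem HiddenLayers.comp_mulVec {ρ : ℝ → ℝ} {d n k : ℕ} (P : Matrix (Fin d) (Fin n) ℝ)
    {g : (Fin d → ℝ) → (Fin k → ℝ)} (hg : HiddenLayers ρ d k g) :
    HiddenLayers ρ n k (fun z => g (P.mulVec z)) := by
  induction hg with
  | first W b =>
    have := HiddenLayers.first (ρ := ρ) (W * P) b
    simpa only [Matrix.mulVec_mulVec] using this
  | next W b g _ ih => exact HiddenLayers.next W b _ ih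

theorem NN.comp_mulVec {ρ : ℝ → ℝ} {d n m k : ℕ} (P : Matrix (Fin d) (Fin n) ℝ)
    {Φ : (Fin d → ℝ) → (Fin m → ℝ)} (hΦ : Φ ∈ NN ρ d m k) :
    (fun z => Φ (P.mulVec z)) ∈ NN ρ n m k := by
  obtain ⟨g, hg, A, c, rfl⟩ := hΦ
  exact ⟨_, hg.comp_mulVec P, A, c, rfl⟩

theorem HiddenLayers.continuous {ρ : ℝ → ℝ} (hρ : Continuous ρ) {n k : ℕ}
    {g : (Fin n → ℝ) → (Fin k → ℝ)} (hg : HiddenLayers ρ n k g) : Continuous g := by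
  induction hg with
  | first W b =>
    exact continuous_pi fun i => hρ.comp
      (((continuous_apply i).comp (Continuous.matrix_mulVec continuous_const continuous_id)).add
        continuous_const)
  | next W b g _ ih =>
    exact continuous_pi fun i => hρ.comp
      (((continuous_apply i).comp (Continuous.matrix_mulVec continuous_const ih)).add
        continuous_const)

theorem NN.continuous {ρ : ℝ → ℝ} (hρ : Continuous ρ) {n m k : ℕ}
    {Φ : (Fin n → ℝ) → (Fin m → ℝ)} (hΦ : Φ ∈ NN ρ n m k) : Continuous Φ := by
  obtain ⟨g, hg, A, c, rfl⟩ := hΦ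
  exact (Continuous.matrix_mulVec continuous_const (hg.continuous hρ)).add continuous_const

/-- The hidden layers can hold, on `K`, the shifted input `x + R`, the shifted value `H x + D` and
an arbitrary ridge function. -/
def Accumulates {d m l k : ℕ} (e : Fin d ⊕ Fin m ⊕ Fin (l + 1) ≃ Fin k) (K : Set (Fin d → ℝ))
    (R : ℝ) (H : (Fin d → ℝ) → (Fin m → ℝ)) : Prop :=
  (∃ B, ∀ x ∈ K, ∀ i, |H x i| ≤ B) ∧
    ∃ D₀, ∀ D, D₀ ≤ D → ∀ (w : Fin d → ℝ) (b : ℝ), ∃ g, HiddenLayers relu d k g ∧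
      ∀ x ∈ K, ∀ j, g x (e j) = Sum.elim (fun i => x i + R)
        (Sum.elim (fun i => H x i + D) (fun _ => relu (w ⬝ᵥ x + b))) j

section accumulators

variable {d m l k : ℕ} {e : Fin d ⊕ Fin m ⊕ Fin (l + 1) ≃ Fin k} {K : Set (Fin d → ℝ)} {R : ℝ}

theorem accumulates_zero (hR : ∀ x ∈ K, ∀ i, 0 ≤ x i + R) :
    Accumulates e K R (fun _ _ => 0) := by
  refine ⟨⟨0, by simp⟩, 0, fun D hD w b => ?_⟩
  refine ⟨_, HiddenLayers.first (Matrix.of fun q => Sum.elim (fun i => Pi.single i 1)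
    (Sum.elim (fun _ => 0) (fun _ => w)) (e.symm q))
    (fun q => Sum.elim (fun _ => R) (Sum.elim (fun _ => D) (fun _ => b)) (e.symm q)), ?_⟩
  rintro x hx (i | i | i)
  · simpa [Matrix.mulVec, relu] using hR x hx i
  · simpa [Matrix.mulVec, relu] using hD
  · simp [Matrix.mulVec]

/-- One layer adds the stored ridge to the running value and loads the next ridge. The shifts `R`
and `D` keep the carried quantities nonnegative, where `relu` is the identity. A later layer may
need a larger `D` from the start, so `Accumulates` asks for every large `D`. -/
theorem Accumulates.add_ridge (hK : IsCompact K) (hR : ∀ x ∈ K, ∀ i, 0 ≤ x i + R)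
    {H : (Fin d → ℝ) → (Fin m → ℝ)} (hH : Accumulates e K R H) (a : Fin m → ℝ) (w : Fin d → ℝ)
    (b : ℝ) : Accumulates e K R (H + fun x i => a i * relu (w ⬝ᵥ x + b)) := by
  obtain ⟨⟨B, hB⟩, D₀, hD₀⟩ := hH
  obtain ⟨C, hC⟩ := hK.exists_bound_of_continuousOn
    (f := fun x (i : Fin m) => a i * relu (w ⬝ᵥ x + b))
    (continuous_pi fun i => continuous_const.mul
      (continuous_relu.comp (by fun_prop))).continuousOn
  have hbd : ∀ x ∈ K, ∀ i, |(H + fun x i => a i * relu (w ⬝ᵥ x + b)) x i| ≤ B + C :=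
    fun x hx i => (abs_add_le _ _).trans (add_le_add (hB x hx i)
      ((norm_le_pi_norm (fun i => a i * relu (w ⬝ᵥ x + b)) i).trans (hC x hx)))
  refine ⟨⟨B + C, hbd⟩, max D₀ (B + C), fun D hD w' b' => ?_⟩
  obtain ⟨g, hg, hgx⟩ := hD₀ D ((le_max_left _ _).trans hD) w b
  -- Only the stored `x + R` is available to form the new ridge; the bias `-∑ i, w' i * R` undoes
  -- the shift.
  refine ⟨_, HiddenLayers.next (Matrix.of fun q => Sum.elim (fun i => Pi.single (e (.inl i)) 1)
    (Sum.elim (fun i => Pi.single (e (.inr (.inl i))) 1 + a i • Pi.single (e (.inr (.inr 0))) 1)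
      (fun _ => ∑ i, w' i • Pi.single (e (.inl i)) 1)) (e.symm q))
    (fun q => Sum.elim (fun _ => 0) (Sum.elim (fun _ => 0) (fun _ => b' - ∑ i, w' i * R))
      (e.symm q)) g hg, ?_⟩
  rintro x hx (i | i | i)
  · simpa [Matrix.mulVec, relu, hgx x hx] using hR x hx i
  · have h1 := (abs_le.1 (hbd x hx i)).1
    have h2 := (le_max_right _ _).trans hD
    simp only [Pi.add_apply] at h1
    simp only [Matrix.mulVec, Matrix.of_apply, Equiv.symm_apply_apply, Sum.elim_inr, Sum.elim_inl,
      add_dotProduct, smul_dotProduct, single_one_dotProduct, hgx x hx, smul_eq_mul, add_zero]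
    change _ = H x i + a i * relu (w ⬝ᵥ x + b) + D
    rw [show H x i + D + a i * relu (w ⬝ᵥ x + b) = H x i + a i * relu (w ⬝ᵥ x + b) + D by ring]
    exact max_eq_left (by linarith)
  · simp only [Matrix.mulVec, Matrix.of_apply, Equiv.symm_apply_apply, Sum.elim_inr, Sum.elim_inl,
      sum_dotProduct, smul_dotProduct, single_one_dotProduct, hgx x hx, smul_eq_mul, mul_add,
      Finset.sum_add_distrib]
    congr 1
    simp only [dotProduct]
    ring

/-- Each scaled generator costs one layer, its scalar being absorbed in `a`. For a sum, the layers
of `Q` are stacked on those of `P`, hence the induction with `H` general. -/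
theorem Accumulates.add_ridgeSpan (hK : IsCompact K) (hR : ∀ x ∈ K, ∀ i, 0 ≤ x i + R)
    {H : (Fin d → ℝ) → (Fin m → ℝ)} (hH : Accumulates e K R H) (a : Fin m → ℝ)
    {P : C(Fin d → ℝ, ℝ)} (hP : P ∈ ridgeSpan d) :
    Accumulates e K R (H + fun x i => a i * P x) := by
  induction hP using Submodule.closure_induction generalizing H with
  | zero =>
    rwa [show (H + fun x i => a i * (0 : C(Fin d → ℝ, ℝ)) x) = H by funext x i; simp]
  | add P Q _ _ hP hQ =>
    have := hQ (hP hH)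
    rwa [add_assoc, show ((fun x i => a i * P x) + fun x i => a i * Q x) =
      fun (x : Fin d → ℝ) (i : Fin m) => a i * (P + Q) x by
        funext x i; simp [mul_add]] at this
  | smul_mem r P hP =>
    obtain ⟨⟨w, b⟩, rfl⟩ := hP
    have := hH.add_ridge hK hR (r • a) w b
    convert this using 4 with x i
    simp only [ridge, ContinuousMap.smul_apply, ContinuousMap.coe_mk, Pi.smul_apply, smul_eq_mul]
    ring

/-- Outputs are filled one coordinate at a time, with direction `a = Pi.single j 1`. -/
theorem accumulates_of_mem_ridgeSpan (hK : IsCompact K) (hR : ∀ x ∈ K, ∀ i, 0 ≤ x i + R)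
    {P : Fin m → C(Fin d → ℝ, ℝ)} (hP : ∀ i, P i ∈ ridgeSpan d) :
    Accumulates e K R (fun x i => P i x) := by
  have key : ∀ s : Finset (Fin m), Accumulates e K R
      (fun x i => ∑ j ∈ s, (Pi.single j 1 : Fin m → ℝ) i * P j x) := by
    intro s
    induction s using Finset.induction_on with
    | empty => simpa using accumulates_zero hR
    | insert j s hj ih =>
      have := ih.add_ridgeSpan hK hR (Pi.single j 1) (hP j)
      convert this using 3 with x i
      rw [Finset.sum_insert hj, Pi.add_apply, Pi.add_apply, add_comm]
  simpa [Pi.single_apply] using key Finset.univ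

end accumulators

/-- **Universal approximation by deep narrow ReLU networks**: networks with `d` inputs, `m` outputs
and at least `d + m + 1` neurons in each hidden layer are dense in the continuous functions on a
compact set. -/
theorem exists_NN_approx {d m k : ℕ} (hk : d + m + 1 ≤ k) {K : Set (Fin d → ℝ)} (hK : IsCompact K)
    {G : (Fin d → ℝ) → (Fin m → ℝ)} (hG : ContinuousOn G K) {δ : ℝ} (hδ : 0 < δ) :
    ∃ Φ ∈ NN relu d m k, ∀ x ∈ K, ∀ i, |G x i - Φ x i| ≤ δ := by
  obtain ⟨l, rfl⟩ := Nat.exists_eq_add_of_le hk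
  -- Surplus width `l` is spent on idle copies of the ridge neuron; only copy `0` is ever read.
  let e : Fin d ⊕ Fin m ⊕ Fin (l + 1) ≃ Fin (d + m + 1 + l) :=
    Fintype.equivFinOfCardEq (by simp; ring)
  obtain ⟨R, hR⟩ := hK.exists_bound_of_continuousOn (f := id) continuousOn_id
  have hR' : ∀ x ∈ K, ∀ i, 0 ≤ x i + R := fun x hx i => by
    have := (norm_le_pi_norm x i).trans (hR x hx)
    rw [Real.norm_eq_abs, abs_le] at this
    linarith [this.1]
  choose P hP hPx using fun i : Fin m => exists_ridgeSpan_approx hK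
    (G := fun x => G x i) (continuousOn_pi.1 hG i) hδ
  obtain ⟨-, D, hD⟩ := accumulates_of_mem_ridgeSpan (e := e) hK hR' hP
  -- The last layer has no further ridge to load, so zeros fill that slot; the output map reads the
  -- values and subtracts `D`.
  obtain ⟨g, hg, hgx⟩ := hD D le_rfl 0 0
  refine ⟨_, ⟨g, hg, Matrix.of fun i => Pi.single (e (.inr (.inl i))) 1, fun _ => -D, rfl⟩,
    fun x hx i => ?_⟩
  simpa [Matrix.mulVec, hgx x hx] using hPx i x hx

/-! ### Grönwall's inequality and global solutions -/

/-- **Grönwall's inequality** in integral form. -/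
theorem le_mul_exp_of_le_add_integral {e : ℝ → ℝ} {a b c K : ℝ} (he : ContinuousOn e (Icc a b))
    (hK : 0 ≤ K) (h : ∀ t ∈ Icc a b, e t ≤ c + K * ∫ s in a..t, e s) :
    ∀ t ∈ Icc a b, e t ≤ c * Real.exp (K * (t - a)) := by
  intro t ht
  have hab : a ≤ b := ht.1.trans ht.2
  -- The extension is continuous on the whole line, so `c + K * ∫ e'` is differentiable everywhere;
  -- its derivative `K * e'` is at most `K` times itself on the interval.
  set e' : ℝ → ℝ := IccExtend hab ((Icc a b).domRestrict e) with he'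
  have he'c : Continuous e' := he.domRestrict.Icc_extend'
  have hee : ∀ s ∈ Icc a b, e' s = e s := fun s hs => IccExtend_of_mem hab _ hs
  have hint : ∀ s ∈ Icc a b, ∫ r in a..s, e r = ∫ r in a..s, e' r := fun s hs =>
    intervalIntegral.integral_congr fun r hr => by
      rw [uIcc_of_le hs.1] at hr
      exact (hee r ⟨hr.1, hr.2.trans hs.2⟩).symm
  have hd : ∀ s, HasDerivAt (fun t => c + K * ∫ r in a..t, e' r) (K * e' s) s := fun s =>
    ((he'c.integral_hasStrictDerivAt a s).hasDerivAt.const_mul K).const_add c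
  have hle : ∀ s ∈ Icc a b, e' s ≤ c + K * ∫ r in a..s, e' r := fun s hs => by
    rw [hee s hs, ← hint s hs]
    exact h s hs
  have := le_gronwallBound_of_liminf_deriv_right_le (f := fun t => c + K * ∫ r in a..t, e' r)
    (f' := fun s => K * e' s) (δ := c) (K := K) (ε := 0) (a := a) (b := b)
    (fun s _ => (hd s).continuousAt.continuousWithinAt)
    (fun s _ r hr => (hd s).hasDerivWithinAt.liminf_right_slope_le hr)
    (by simp) (fun s hs => by
      rw [add_zero]
      exact mul_le_mul_of_nonneg_left (hle s ⟨hs.1, hs.2.le⟩) hK) t ht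
  rw [gronwallBound_ε0] at this
  rw [← hee t ht]
  exact (hle t ht).trans this

/-- An a priori bound from linear growth: Grönwall for `‖x‖`, with the contribution of `A` taken
over the whole interval to make the constant independent of `t`. -/
theorem norm_le_of_eq_add_integral {E : Type*} [NormedAddCommGroup E] [NormedSpace ℝ E]
    {x v : ℝ → E} {x₀ : E} {a b A K : ℝ} (hA : 0 ≤ A) (hK : 0 ≤ K)
    (hx : ContinuousOn x (Icc a b)) (hv : ∀ t ∈ Icc a b, ‖v t‖ ≤ A + K * ‖x t‖)
    (h : ∀ t ∈ Icc a b, x t = x₀ + ∫ s in a..t, v s) :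
    ∀ t ∈ Icc a b, ‖x t‖ ≤ (‖x₀‖ + A * (b - a)) * Real.exp (K * (b - a)) := by
  intro t ht
  have key := le_mul_exp_of_le_add_integral (e := fun t => ‖x t‖) (c := ‖x₀‖ + A * (b - a))
    hx.norm hK (fun t ht => ?_) t ht
  · refine key.trans (mul_le_mul_of_nonneg_left (Real.exp_le_exp.2 ?_) ?_)
    · exact mul_le_mul_of_nonneg_left (by linarith [ht.2]) hK
    · have := ht.1.trans ht.2
      have := sub_nonneg.2 this
      positivity
  · have hsub : Icc a t ⊆ Icc a b := Icc_subset_Icc_right ht.2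
    have hxi : IntervalIntegrable (fun s => ‖x s‖) volume a t :=
      (hx.norm.mono (by rwa [uIcc_of_le ht.1])).intervalIntegrable
    have h1 : ‖∫ s in a..t, v s‖ ≤ ∫ s in a..t, (A + K * ‖x s‖) := by
      refine intervalIntegral.norm_integral_le_of_norm_le ht.1 ?_
        (intervalIntegrable_const.add (hxi.const_mul K))
      exact Filter.Eventually.of_forall fun s hs => hv s (hsub ⟨hs.1.le, hs.2⟩)
    rw [intervalIntegral.integral_add intervalIntegrable_const (hxi.const_mul K),
      intervalIntegral.integral_const, intervalIntegral.integral_const_mul, smul_eq_mul] at h1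
    have h2 : ‖x t‖ ≤ ‖x₀‖ + ‖∫ s in a..t, v s‖ := by
      rw [h t ht]
      exact norm_add_le _ _
    have h3 : (t - a) * A ≤ A * (b - a) := by nlinarith [ht.2]
    linarith

/-- The coordinatewise projection onto the cube `[-r, r]^n`. -/
noncomputable def clampVec {n : ℕ} (r : ℝ) (x : Vec n) : Vec n :=
  WithLp.toLp 2 fun i => max (-r) (min r (x i))

theorem norm_clampVec_sub_le {n : ℕ} (r : ℝ) (x y : Vec n) :
    ‖clampVec r x - clampVec r y‖ ≤ ‖x - y‖ := by
  rw [EuclideanSpace.norm_eq, EuclideanSpace.norm_eq]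
  refine Real.sqrt_le_sqrt (Finset.sum_le_sum fun i _ => ?_)
  refine pow_le_pow_left₀ (norm_nonneg _) ?_ 2
  simp only [clampVec, PiLp.sub_apply, Real.norm_eq_abs]
  refine (abs_max_sub_max_le_max _ _ _ _).trans ?_
  rw [sub_self, abs_zero]
  refine max_le (abs_nonneg _) ((abs_min_sub_min_le_max _ _ _ _).trans ?_)
  rw [sub_self, abs_zero]
  exact max_le (abs_nonneg _) le_rfl

theorem clampVec_zero {n : ℕ} {r : ℝ} (hr : 0 ≤ r) : clampVec r (0 : Vec n) = 0 := by
  ext i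
  simp [clampVec, hr]

theorem clampVec_eq_self {n : ℕ} {r : ℝ} {x : Vec n} (hx : ‖x‖ ≤ r) : clampVec r x = x := by
  ext i
  have := (PiLp.norm_apply_le x i).trans hx
  rw [Real.norm_eq_abs, abs_le] at this
  simp [clampVec, this.1, this.2]

theorem norm_clampVec_le {n : ℕ} {r : ℝ} (hr : 0 ≤ r) (x : Vec n) :
    ‖clampVec r x‖ ≤ Real.sqrt (n * r ^ 2) := by
  rw [EuclideanSpace.norm_eq]
  refine Real.sqrt_le_sqrt ?_
  calc ∑ i, ‖clampVec r x i‖ ^ 2 ≤ ∑ _i : Fin n, r ^ 2 := by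
        refine Finset.sum_le_sum fun i _ => pow_le_pow_left₀ (norm_nonneg _) ?_ 2
        simp only [clampVec, Real.norm_eq_abs]
        exact abs_le.2 ⟨le_max_left _ _, max_le (by linarith) (min_le_left _ _)⟩
    _ = n * r ^ 2 := by simp

/-- A globally Lipschitz differential equation has a solution on the whole interval. -/
theorem exists_eq_add_integral_of_lipschitz {n : ℕ} {G : ℝ → Vec n → Vec n} {a b K : ℝ}
    (hab : a ≤ b) (hK : 0 ≤ K)
    (hLip : ∀ t ∈ Icc a b, ∀ x y, ‖G t x - G t y‖ ≤ K * ‖x - y‖)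
    (hcont : ∀ x, ContinuousOn (fun t => G t x) (Icc a b)) (x₀ : Vec n) :
    ∃ x : ℝ → Vec n, ContinuousOn x (Icc a b) ∧
      ContinuousOn (fun t => G t (x t)) (Icc a b) ∧
      ∀ t ∈ Icc a b, x t = x₀ + ∫ s in a..t, G s (x s) := by
  obtain ⟨A, hA⟩ := isCompact_Icc.exists_bound_of_continuousOn (hcont 0)
  have hA0 : 0 ≤ A := (norm_nonneg _).trans (hA a ⟨le_rfl, hab⟩)
  have hgrowth : ∀ t ∈ Icc a b, ∀ y, ‖G t y‖ ≤ A + K * ‖y‖ := fun t ht y => by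
    have h1 := hLip t ht y 0
    rw [sub_zero] at h1
    have h2 := norm_le_norm_sub_add (G t y) (G t 0)
    linarith [hA t ht]
  set r : ℝ := (‖x₀‖ + A * (b - a)) * Real.exp (K * (b - a)) with hr
  have hba := sub_nonneg.2 hab
  have hr0 : 0 ≤ r := by positivity
  -- Clamping makes the field bounded, so Picard–Lindelöf covers all of `[a, b]` at once. The clamp
  -- is nonexpansive and fixes `0`, so the Lipschitz and growth bounds survive; the solution then
  -- obeys the a priori bound `r`, and there the clamp does nothing.
  have hLip' : ∀ t ∈ Icc a b, LipschitzWith K.toNNReal (fun y => G t (clampVec r y)) :=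
    fun t ht => LipschitzWith.of_dist_le_mul fun y z => by
      rw [dist_eq_norm, dist_eq_norm, Real.coe_toNNReal K hK]
      exact (hLip t ht _ _).trans (mul_le_mul_of_nonneg_left (norm_clampVec_sub_le r y z) hK)
  set C : ℝ := A + K * Real.sqrt (n * r ^ 2) with hC
  have hC0 : 0 ≤ C := by positivity
  have hPL : IsPicardLindelof (fun t y => G t (clampVec r y)) (⟨a, le_rfl, hab⟩ : Icc a b) x₀
      (C * (b - a)).toNNReal 0 C.toNNReal K.toNNReal :=
    { lipschitzOnWith := fun t ht => (hLip' t ht).lipschitzOnWith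
      continuousOn := fun y _ => hcont _
      norm_le := fun t ht y _ => by
        rw [Real.coe_toNNReal C hC0]
        exact (hgrowth t ht _).trans (by
          have := mul_le_mul_of_nonneg_left (norm_clampVec_le hr0 y) hK
          linarith)
      mul_max_le := by
        rw [Real.coe_toNNReal C hC0, Real.coe_toNNReal _ (by positivity)]
        simp [hab] }
  obtain ⟨x, hx0, hx⟩ := hPL.exists_eq_forall_mem_Icc_hasDerivWithinAt₀
  have hxc : ContinuousOn x (Icc a b) := fun t ht => (hx t ht).continuousWithinAt
  have hc' : ContinuousOn (fun t => G t (clampVec r (x t))) (Icc a b) := by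
    have h1 : ContinuousOn (fun q : ℝ × Vec n => G q.1 (clampVec r q.2)) (Icc a b ×ˢ univ) :=
      continuousOn_prod_of_continuousOn_lipschitzOnWith' _ K.toNNReal
        (fun t ht => (hLip' t ht).lipschitzOnWith) (fun y _ => hcont (clampVec r y))
    exact h1.comp (continuousOn_id.prodMk hxc) fun t ht => ⟨ht, mem_univ _⟩
  have heq : ∀ t ∈ Icc a b, x t = x₀ + ∫ s in a..t, G s (clampVec r (x s)) := by
    intro t ht
    have hsub : Icc a t ⊆ Icc a b := Icc_subset_Icc_right ht.2
    have := intervalIntegral.integral_eq_sub_of_hasDeriv_right_of_le ht.1 (hxc.mono hsub)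
      (fun s hs => ((hx s ⟨hs.1.le, hs.2.le.trans ht.2⟩).mono_of_mem_nhdsWithin
        (mem_nhdsWithin_of_mem_nhds (Icc_mem_nhds hs.1 (hs.2.trans_le ht.2)))))
      ((hc'.mono (by rwa [uIcc_of_le ht.1])).intervalIntegrable)
    rw [this]
    have hx0' : x a = x₀ := hx0
    rw [hx0']
    abel
  have hbd := norm_le_of_eq_add_integral hA0 hK hxc (fun t ht => (hgrowth t ht _).trans (by
    have := mul_le_mul_of_nonneg_left (norm_clampVec_sub_le r (x t) 0) hK
    rw [clampVec_zero hr0, sub_zero, sub_zero] at this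
    linarith)) heq
  have hcl : ∀ t ∈ Icc a b, clampVec r (x t) = x t := fun t ht => clampVec_eq_self (hbd t ht)
  refine ⟨x, hxc, hc'.congr fun t ht => by simp only [hcl t ht], fun t ht => ?_⟩
  rw [heq t ht]
  congr 1
  refine intervalIntegral.integral_congr fun s hs => ?_
  rw [uIcc_of_le ht.1] at hs
  simp only [hcl s ⟨hs.1, hs.2.trans ht.2⟩]

/-! ### Trajectories and their dependence on the control -/

section trajectories

variable {nx nu : ℕ} {F : Vec nx → Vec nu → ℝ → Vec nx}

theorem IsTrajectory.continuousOn {a b : ℝ} {x₀ : Vec nx} {x : ℝ → Vec nx} {u : ℝ → Vec nu}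
    (h : IsTrajectory F a b x₀ x u) : ContinuousOn x (Icc a b) := by
  rcases le_or_gt a b with hab | hab
  · have h1 := intervalIntegral.continuousOn_primitive_interval' h.1 left_mem_uIcc
    rw [uIcc_of_le hab] at h1
    exact (continuousOn_const.add h1).congr h.2
  · simp [Icc_eq_empty hab.not_ge]

theorem continuousOn_field_of_lipschitz {a b M : ℝ} (hM : 0 ≤ M)
    (hLip : ∀ t ∈ Icc a b, ∀ x y : Vec nx, ∀ u v : Vec nu,
      ‖F x u t - F y v t‖ ≤ M * (‖x - y‖ + ‖u - v‖))
    (hCont : ∀ x u, ContinuousOn (fun t => F x u t) (Icc a b))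
    {v : ℝ → Vec nu} (hv : ContinuousOn v (Icc a b)) (y : Vec nx) :
    ContinuousOn (fun t => F y (v t) t) (Icc a b) := by
  have h1 : ContinuousOn (fun q : ℝ × Vec nu => F y q.2 q.1) (Icc a b ×ˢ univ) := by
    refine continuousOn_prod_of_continuousOn_lipschitzOnWith' _ M.toNNReal
      (fun t ht => LipschitzOnWith.of_dist_le_mul fun w _ z _ => ?_) (fun w _ => hCont _ _)
    rw [dist_eq_norm, dist_eq_norm, Real.coe_toNNReal M hM]
    simpa using hLip t ht y y w z
  exact h1.comp (continuousOn_id.prodMk hv) fun t ht => ⟨ht, mem_univ _⟩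

/-- Continuous controls have trajectories. -/
theorem exists_isTrajectory_of_continuousOn {a b M : ℝ} (hab : a ≤ b) (hM : 0 ≤ M)
    (hLip : ∀ t ∈ Icc a b, ∀ x y : Vec nx, ∀ u v : Vec nu,
      ‖F x u t - F y v t‖ ≤ M * (‖x - y‖ + ‖u - v‖))
    (hCont : ∀ x u, ContinuousOn (fun t => F x u t) (Icc a b))
    {v : ℝ → Vec nu} (hv : ContinuousOn v (Icc a b)) (x₀ : Vec nx) :
    ∃ x, IsTrajectory F a b x₀ x v := by
  obtain ⟨x, -, hc, hx⟩ := exists_eq_add_integral_of_lipschitz (G := fun t y => F y (v t) t) hab hM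
    (fun t ht y z => by simpa using hLip t ht y z (v t) (v t))
    (continuousOn_field_of_lipschitz hM hLip hCont hv) x₀
  exact ⟨x, (hc.mono (by rw [uIcc_of_le hab])).intervalIntegrable, hx⟩

/-- Trajectories depend on the control in a Lipschitz way. -/
theorem IsTrajectory.norm_sub_le {b M : ℝ} (hM : 0 ≤ M)
    (hLip : ∀ t ∈ Icc 0 b, ∀ x y : Vec nx, ∀ u v : Vec nu,
      ‖F x u t - F y v t‖ ≤ M * (‖x - y‖ + ‖u - v‖))
    {x₀ : Vec nx} {x y : ℝ → Vec nx} {u v : ℝ → Vec nu}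
    (hx : IsTrajectory F 0 b x₀ x u) (hy : IsTrajectory F 0 b x₀ y v)
    (huv : IntervalIntegrable (fun s => u s - v s) volume 0 b) {t : ℝ} (ht : t ∈ Icc 0 b) :
    ‖x t - y t‖ ≤ M * Real.exp (M * t) * ∫ s in (0 : ℝ)..t, ‖u s - v s‖ := by
  have hsub : Icc 0 t ⊆ Icc 0 b := Icc_subset_Icc_right ht.2
  have hbI : uIcc 0 t ⊆ uIcc 0 b := by
    rw [uIcc_of_le ht.1, uIcc_of_le (ht.1.trans ht.2)]
    exact hsub
  have hec : ContinuousOn (fun s => ‖x s - y s‖) (Icc 0 t) :=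
    ((hx.continuousOn.sub hy.continuousOn).norm).mono hsub
  -- Grönwall runs on `[0, t]`, with the control error up to the final time `t` frozen as the
  -- constant.
  have key := le_mul_exp_of_le_add_integral (e := fun s => ‖x s - y s‖)
    (c := M * ∫ s in (0 : ℝ)..t, ‖u s - v s‖) hec hM (fun s hs => ?_) t ⟨ht.1, le_rfl⟩
  · rw [sub_zero] at key
    linarith
  · have hsb : s ∈ Icc 0 b := hsub hs
    have hbs : uIcc 0 s ⊆ uIcc 0 b := by
      rw [uIcc_of_le hs.1, uIcc_of_le (ht.1.trans ht.2)]
      exact Icc_subset_Icc_right hsb.2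
    have hei : IntervalIntegrable (fun r => ‖x r - y r‖) volume 0 s :=
      (hec.mono (by rw [uIcc_of_le hs.1]; exact Icc_subset_Icc_right hs.2)).intervalIntegrable
    have hwi : IntervalIntegrable (fun r => ‖u r - v r‖) volume 0 s := (huv.mono_set hbs).norm
    have hwt : IntervalIntegrable (fun r => ‖u r - v r‖) volume 0 t := (huv.mono_set hbI).norm
    have h1 : x s - y s = ∫ r in (0 : ℝ)..s, (F (x r) (u r) r - F (y r) (v r) r) := by
      rw [intervalIntegral.integral_sub (hx.1.mono_set hbs) (hy.1.mono_set hbs), hx.2 s hsb,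
        hy.2 s hsb]
      abel
    have h2 : ‖x s - y s‖ ≤ ∫ r in (0 : ℝ)..s, M * (‖x r - y r‖ + ‖u r - v r‖) := by
      rw [h1]
      refine intervalIntegral.norm_integral_le_of_norm_le hs.1 ?_ ((hei.add hwi).const_mul M)
      exact Filter.Eventually.of_forall fun r hr =>
        hLip r ⟨hr.1.le, hr.2.trans hsb.2⟩ _ _ _ _
    rw [intervalIntegral.integral_const_mul, intervalIntegral.integral_add hei hwi] at h2
    have h3 : ∫ r in (0 : ℝ)..s, ‖u r - v r‖ ≤ ∫ r in (0 : ℝ)..t, ‖u r - v r‖ :=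
      intervalIntegral.integral_mono_interval le_rfl hs.1 hs.2
        (Filter.Eventually.of_forall fun r => norm_nonneg _) hwt
    nlinarith

end trajectories

/-! ### Dynamic programming -/

theorem IntervalIntegrable.of_eqOn_of_eqOn {E : Type*} [NormedAddCommGroup E] {f g h : ℝ → E}
    {a b c : ℝ} (hac : a ≤ c) (hcb : c ≤ b) (hf : IntervalIntegrable f volume a c)
    (hg : IntervalIntegrable g volume c b) (h₁ : ∀ s ∈ Ioc a c, h s = f s)
    (h₂ : ∀ s ∈ Ioc c b, h s = g s) : IntervalIntegrable h volume a b := by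
  refine (hf.congr ?_).trans (hg.congr ?_)
  · rw [uIoc_of_le hac]
    exact fun s hs => (h₁ s hs).symm
  · rw [uIoc_of_le hcb]
    exact fun s hs => (h₂ s hs).symm

theorem intervalIntegral_congr_Ioc {E : Type*} [NormedAddCommGroup E] [NormedSpace ℝ E]
    {f g : ℝ → E} {a b : ℝ} (hab : a ≤ b) (h : ∀ s ∈ Ioc a b, f s = g s) :
    ∫ s in a..b, f s = ∫ s in a..b, g s :=
  intervalIntegral.integral_congr_ae (Filter.Eventually.of_forall fun s hs => h s (by
    rwa [uIoc_of_le hab] at hs))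

section valueFunction

variable {nx nu : ℕ} {F : Vec nx → Vec nu → ℝ → Vec nx} {L : Vec nx → Vec nu → ℝ}
  {ψ : Vec nx → ℝ} {tf : ℝ}

/-- Concatenation of admissible pairs, and its cost. -/
theorem IsAdmissible.exists_trans {a b c : ℝ} (hac : a ≤ c) (hcb : c ≤ b) {x₀ : Vec nx}
    {x y : ℝ → Vec nx} {u v : ℝ → Vec nu} (hx : IsAdmissible F L a c x₀ x u)
    (hy : IsAdmissible F L c b (x c) y v) :
    ∃ z w, IsAdmissible F L a b x₀ z w ∧
      cost L ψ a b z w = (∫ s in a..c, L (x s) (u s)) + cost L ψ c b y v := by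
  obtain ⟨hu, ⟨hxi, hxe⟩, hxL⟩ := hx
  obtain ⟨hv, ⟨hyi, hye⟩, hyL⟩ := hy
  have hyc : y c = x c := by simpa using hye c ⟨le_rfl, hcb⟩
  set z : ℝ → Vec nx := fun s => if s ≤ c then x s else y s with hz
  set w : ℝ → Vec nu := fun s => if s ≤ c then u s else v s with hw
  have hz₁ : ∀ s ∈ Ioc a c, z s = x s := fun s hs => if_pos hs.2
  have hz₂ : ∀ s ∈ Ioc c b, z s = y s := fun s hs => if_neg hs.1.not_ge
  have hw₁ : ∀ s ∈ Ioc a c, w s = u s := fun s hs => if_pos hs.2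
  have hw₂ : ∀ s ∈ Ioc c b, w s = v s := fun s hs => if_neg hs.1.not_ge
  have hF₁ : ∀ s ∈ Ioc a c, F (z s) (w s) s = F (x s) (u s) s := fun s hs => by
    rw [hz₁ s hs, hw₁ s hs]
  have hF₂ : ∀ s ∈ Ioc c b, F (z s) (w s) s = F (y s) (v s) s := fun s hs => by
    rw [hz₂ s hs, hw₂ s hs]
  have hL₁ : ∀ s ∈ Ioc a c, L (z s) (w s) = L (x s) (u s) := fun s hs => by
    rw [hz₁ s hs, hw₁ s hs]
  have hL₂ : ∀ s ∈ Ioc c b, L (z s) (w s) = L (y s) (v s) := fun s hs => by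
    rw [hz₂ s hs, hw₂ s hs]
  have hFi := IntervalIntegrable.of_eqOn_of_eqOn hac hcb hxi hyi hF₁ hF₂
  have hLi := IntervalIntegrable.of_eqOn_of_eqOn hac hcb hxL hyL hL₁ hL₂
  have huac : uIcc a c ⊆ uIcc a b := by
    rw [uIcc_of_le hac, uIcc_of_le (hac.trans hcb)]
    exact Icc_subset_Icc_right hcb
  have hucb : uIcc c b ⊆ uIcc a b := by
    rw [uIcc_of_le hcb, uIcc_of_le (hac.trans hcb)]
    exact Icc_subset_Icc_left hac
  refine ⟨z, w, ⟨IntervalIntegrable.of_eqOn_of_eqOn hac hcb hu hv hw₁ hw₂, ⟨hFi, fun t ht => ?_⟩,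
    hLi⟩, ?_⟩
  · rcases le_or_gt t c with htc | htc
    · rw [intervalIntegral_congr_Ioc ht.1 (fun s hs => hF₁ s ⟨hs.1, hs.2.trans htc⟩),
        ← hxe t ⟨ht.1, htc⟩, hz]
      exact if_pos htc
    · have hct : uIcc c t ⊆ uIcc a b := by
        rw [uIcc_of_le htc.le, uIcc_of_le (hac.trans hcb)]
        exact Icc_subset_Icc hac ht.2
      rw [← intervalIntegral.integral_add_adjacent_intervals (hFi.mono_set huac)
        (hFi.mono_set hct), intervalIntegral_congr_Ioc hac hF₁,
        intervalIntegral_congr_Ioc htc.le (fun s hs => hF₂ s ⟨hs.1, hs.2.trans ht.2⟩), ← add_assoc,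
        ← hxe c ⟨hac, le_rfl⟩, ← hye t ⟨htc.le, ht.2⟩]
      exact if_neg htc.not_ge
  -- The terminal cost sees the single time `b`. If `c = b`, the concatenation is there on its first
  -- branch, which agrees since `y c = x c`.
  · have hzb : z b = y b := by
      rcases hcb.eq_or_lt with rfl | hlt
      · rw [hyc]
        exact if_pos le_rfl
      · exact hz₂ b ⟨hlt, le_rfl⟩
    rw [cost, cost, hzb, ← intervalIntegral.integral_add_adjacent_intervals (hLi.mono_set huac)
        (hLi.mono_set hucb), intervalIntegral_congr_Ioc hac hL₁,
        intervalIntegral_congr_Ioc hcb hL₂, add_assoc]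

/-- The dynamic programming inequality. -/
theorem IsValueFunction.le_integral_add {V : Vec nx → ℝ → ℝ} (hV : IsValueFunction F L ψ tf V)
    {t t' : ℝ} (ht : 0 ≤ t) (htt' : t ≤ t') (ht' : t' ≤ tf) {x₀ : Vec nx} {x : ℝ → Vec nx}
    {u : ℝ → Vec nu} (hx : IsAdmissible F L t t' x₀ x u) :
    V x₀ t ≤ (∫ s in t..t', L (x s) (u s)) + V (x t') t' := by
  -- In this form the left side need only be a lower bound for all costs from `(x t', t')`, so no
  -- minimizer is required.
  have h1 : V x₀ t - (∫ s in t..t', L (x s) (u s)) ≤ V (x t') t' := by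
    refine (hV (x t') t' ⟨ht.trans htt', ht'⟩).2 ?_
    rintro _ ⟨y, v, hy, rfl⟩
    obtain ⟨z, w, hzw, hc⟩ := hx.exists_trans (ψ := ψ) htt' ht' hy
    have := (hV x₀ t ⟨ht, htt'.trans ht'⟩).1 ⟨z, w, hzw, rfl⟩
    rw [hc] at this
    linarith
  linarith

/-- Under the zero control from `y`, the running cost and the displacement over `[t, t']` are `O(t'
- t)`, and `V` is Lipschitz in the state. The radius `ρ` uses the full horizon `tf`, so `C` does not
depend on `t` and `t'`. -/
theorem IsValueFunction.exists_le_add_mul_sub {V : Vec nx → ℝ → ℝ}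
    (hV : IsValueFunction F L ψ tf V) (htf : 0 ≤ tf) {M : ℝ} (hM : 0 ≤ M)
    (hLip : ∀ t ∈ Icc 0 tf, ∀ x y : Vec nx, ∀ u v : Vec nu,
      ‖F x u t - F y v t‖ ≤ M * (‖x - y‖ + ‖u - v‖))
    (hCont : ∀ x u, ContinuousOn (fun t => F x u t) (Icc 0 tf))
    (hLMeas : Measurable (fun z : Vec nx × Vec nu => L z.1 z.2))
    (hLBdd : ∀ r : ℝ, ∃ B : ℝ, ∀ x u, ‖x‖ ≤ r → ‖u‖ ≤ r → |L x u| ≤ B)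
    {γ : ℝ} (hγ : 0 ≤ γ) (hVLip : ∀ t ∈ Icc 0 tf, ∀ x y : Vec nx, |V x t - V y t| ≤ γ * ‖x - y‖)
    (y : Vec nx) :
    ∃ C : ℝ, ∀ t ∈ Icc 0 tf, ∀ t' ∈ Icc 0 tf, t ≤ t' → V y t ≤ V y t' + C * (t' - t) := by
  obtain ⟨A, hA⟩ := isCompact_Icc.exists_bound_of_continuousOn (hCont 0 0)
  have hA0 : 0 ≤ A := (norm_nonneg _).trans (hA 0 ⟨le_rfl, htf⟩)
  have hgrowth : ∀ t ∈ Icc 0 tf, ∀ z, ‖F z 0 t‖ ≤ A + M * ‖z‖ := fun t ht z => by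
    have h1 := hLip t ht z 0 0 0
    rw [sub_zero, sub_zero, norm_zero, add_zero] at h1
    have h2 := norm_le_norm_sub_add (F z 0 t) (F 0 0 t)
    linarith [hA t ht]
  set ρ : ℝ := (‖y‖ + A * tf) * Real.exp (M * tf) with hρ
  have hρ0 : 0 ≤ ρ := by positivity
  obtain ⟨B, hB⟩ := hLBdd ρ
  refine ⟨B + γ * (A + M * ρ), fun t ht t' ht' htt' => ?_⟩
  have hsub : Icc t t' ⊆ Icc 0 tf := Icc_subset_Icc ht.1 ht'.2
  obtain ⟨x, hx⟩ := exists_isTrajectory_of_continuousOn (F := F) htt' hM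
    (fun s hs => hLip s (hsub hs)) (fun z u => (hCont z u).mono hsub)
    (v := fun _ => 0) continuousOn_const y
  have hxρ : ∀ s ∈ Icc t t', ‖x s‖ ≤ ρ := fun s hs => by
    refine (norm_le_of_eq_add_integral hA0 hM hx.continuousOn
      (fun s hs => hgrowth s (hsub hs) _) hx.2 s hs).trans ?_
    have h1 : t' - t ≤ tf := by linarith [ht.1, ht'.2]
    have h2 : 0 ≤ t' - t := sub_nonneg.2 htt'
    rw [hρ]
    gcongr
  have hLb : ∀ s ∈ Icc t t', ‖L (x s) 0‖ ≤ B := fun s hs =>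
    hB _ _ (hxρ s hs) (by simpa using hρ0)
  have hLi : IntervalIntegrable (fun s => L (x s) 0) volume t t' := by
    rw [intervalIntegrable_iff_integrableOn_Icc_of_le htt']
    refine IntegrableOn.of_bound (C := B) measure_Icc_lt_top ?_ ?_
    · have h1 : AEMeasurable x (volume.restrict (Icc t t')) :=
        hx.continuousOn.aemeasurable measurableSet_Icc
      exact (hLMeas.comp_aemeasurable (h1.prodMk aemeasurable_const)).aestronglyMeasurable
    · exact (ae_restrict_mem measurableSet_Icc).mono hLb
  have h1 := hV.le_integral_add ht.1 htt' ht'.2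
    (⟨intervalIntegrable_const, hx, hLi⟩ : IsAdmissible F L t t' y x (fun _ => 0))
  have h2 : ‖∫ s in t..t', L (x s) 0‖ ≤ B * |t' - t| :=
    intervalIntegral.norm_integral_le_of_norm_le_const fun s hs => by
      rw [uIoc_of_le htt'] at hs
      exact hLb s ⟨hs.1.le, hs.2⟩
  have h3 : ‖x t' - y‖ ≤ (A + M * ρ) * |t' - t| := by
    rw [hx.2 t' ⟨htt', le_rfl⟩, add_sub_cancel_left]
    refine intervalIntegral.norm_integral_le_of_norm_le_const fun s hs => ?_
    rw [uIoc_of_le htt'] at hs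
    have hs' : s ∈ Icc t t' := ⟨hs.1.le, hs.2⟩
    refine (hgrowth s (hsub hs') _).trans ?_
    have := mul_le_mul_of_nonneg_left (hxρ s hs') hM
    linarith
  rw [abs_of_nonneg (sub_nonneg.2 htt')] at h2 h3
  have h4 := (abs_le.1 (hVLip t' ht' (x t') y)).2
  have h5 := mul_le_mul_of_nonneg_left h3 hγ
  have h6 := (abs_le.1 h2).2
  nlinarith

end valueFunction

/-! ### Regularity in time from a one-sided bound -/

section regularity

variable {f : ℝ → ℝ} {a b C : ℝ}

/-- The bound says exactly that `f t + C * t` is monotone on the interval, and monotone functions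
are measurable. -/
theorem measurable_comp_projIcc_of_le_add (hab : a ≤ b)
    (h : ∀ t ∈ Icc a b, ∀ t' ∈ Icc a b, t ≤ t' → f t ≤ f t' + C * (t' - t)) :
    Measurable fun t => f (projIcc a b hab t) := by
  have hmono : Monotone fun t => f (projIcc a b hab t) + C * (projIcc a b hab t : ℝ) :=
    fun s t hst => by
      have := h _ (projIcc a b hab s).2 _ (projIcc a b hab t).2 (monotone_projIcc hab hst)
      simp only
      linarith
  have hm : Measurable fun t => C * (projIcc a b hab t : ℝ) :=
    (continuous_const.mul (continuous_subtype_val.comp continuous_projIcc)).measurable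
  convert hmono.measurable.sub hm using 1
  funext t
  simp

theorem exists_abs_le_of_le_add (hab : a ≤ b)
    (h : ∀ t ∈ Icc a b, ∀ t' ∈ Icc a b, t ≤ t' → f t ≤ f t' + C * (t' - t)) :
    ∃ B, ∀ t ∈ Icc a b, |f t| ≤ B := by
  refine ⟨|f a| + |f b| + |C| * (b - a), fun t ht => ?_⟩
  have h1 := h a ⟨le_rfl, hab⟩ t ht ht.1
  have h2 := h t ht b ⟨hab, le_rfl⟩ ht.2
  have h3 : C * (t - a) ≤ |C| * (b - a) :=
    (mul_le_mul_of_nonneg_right (le_abs_self C) (sub_nonneg.2 ht.1)).trans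
      (mul_le_mul_of_nonneg_left (by linarith [ht.2]) (abs_nonneg C))
  have h4 : C * (b - t) ≤ |C| * (b - a) :=
    (mul_le_mul_of_nonneg_right (le_abs_self C) (sub_nonneg.2 ht.2)).trans
      (mul_le_mul_of_nonneg_left (by linarith [ht.1]) (abs_nonneg C))
  rw [abs_le]
  constructor <;> linarith [neg_abs_le (f a), le_abs_self (f b), abs_nonneg (f a), abs_nonneg (f b)]

end regularity

/-! ### Tools in `L^p` -/

/-- Minkowski's inequality in which one function is arbitrary. -/
theorem lintegral_Lp_add_le_of_aemeasurable_left {α : Type*} [MeasurableSpace α] {μ : Measure α}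
    {f g : α → ENNReal} (hf : AEMeasurable f μ) {p : ℝ} (hp : 1 ≤ p) :
    (∫⁻ a, (f a + g a) ^ p ∂μ) ^ (1 / p) ≤
      (∫⁻ a, f a ^ p ∂μ) ^ (1 / p) + (∫⁻ a, g a ^ p ∂μ) ^ (1 / p) := by
  have hp0 : 0 < p := by linarith
  -- A measurable minorant `G` with the same integral replaces the sum. Then `G ^ (1 / p) - f` is
  -- measurable and at most `g`, so the usual Minkowski inequality applies to it and `f`.
  obtain ⟨G, hG, hle, heq⟩ := exists_measurable_le_lintegral_eq μ fun a => (f a + g a) ^ p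
  have hk : AEMeasurable (fun a => G a ^ (1 / p)) μ := (hG.pow_const _).aemeasurable
  have hkle : ∀ a, G a ^ (1 / p) ≤ f a + g a := fun a => by
    have := ENNReal.rpow_le_rpow (hle a) (by positivity : 0 ≤ 1 / p)
    rwa [← ENNReal.rpow_mul, mul_one_div_cancel hp0.ne', ENNReal.rpow_one] at this
  have h1 : ∫⁻ a, (f a + g a) ^ p ∂μ ≤ ∫⁻ a, (f + fun a => G a ^ (1 / p) - f a) a ^ p ∂μ := by
    rw [heq]
    refine lintegral_mono fun a => ?_
    calc G a = (G a ^ (1 / p)) ^ p := by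
          rw [← ENNReal.rpow_mul, one_div_mul_cancel hp0.ne', ENNReal.rpow_one]
      _ ≤ _ := ENNReal.rpow_le_rpow le_add_tsub hp0.le
  refine (ENNReal.rpow_le_rpow h1 (by positivity)).trans
    ((ENNReal.lintegral_Lp_add_le hf (hk.sub hf) hp).trans ?_)
  gcongr with a
  exact tsub_le_iff_left.2 (hkle a)

/-- Here `g` will be the error of the value network along a trajectory, whose measurability is then
not needed. -/
theorem eLpNorm_le_add_of_norm_le {α : Type*} [MeasurableSpace α] {μ : Measure α} {k f g : α → ℝ}
    (hf : AEStronglyMeasurable f μ) {p : ℝ} (hp : 1 ≤ p)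
    (h : ∀ᵐ a ∂μ, ‖k a‖ ≤ ‖f a‖ + ‖g a‖) :
    eLpNorm k (ENNReal.ofReal p) μ ≤
      eLpNorm f (ENNReal.ofReal p) μ + eLpNorm g (ENNReal.ofReal p) μ := by
  have hp0 : 0 < p := by linarith
  have h0 : ENNReal.ofReal p ≠ 0 := by simpa using hp0
  simp only [eLpNorm_eq_lintegral_rpow_enorm_toReal h0 ENNReal.ofReal_ne_top,
    ENNReal.toReal_ofReal hp0.le]
  refine le_trans (ENNReal.rpow_le_rpow (lintegral_mono_ae ?_) (by positivity))
    (lintegral_Lp_add_le_of_aemeasurable_left hf.enorm hp)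
  filter_upwards [h] with a ha
  refine ENNReal.rpow_le_rpow ?_ hp0.le
  rw [← ofReal_norm, ← ofReal_norm, ← ofReal_norm,
    ← ENNReal.ofReal_add (norm_nonneg _) (norm_nonneg _)]
  exact ENNReal.ofReal_le_ofReal ha

theorem exists_pos_forall_eLpNorm_le {α : Type*} [MeasurableSpace α] (μ : Measure α)
    [IsFiniteMeasure μ] (E : Type*) [NormedAddCommGroup E] (p : ENNReal) {δ : ℝ} (hδ : 0 < δ) :
    ∃ η > 0, η ≤ δ ∧ ∀ f : α → E, (∀ᵐ a ∂μ, ‖f a‖ ≤ η) → eLpNorm f p μ ≤ ENNReal.ofReal δ := by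
  have hfin : μ univ ^ p.toReal⁻¹ ≠ ⊤ :=
    ENNReal.rpow_ne_top_of_nonneg (by positivity) (measure_ne_top _ _)
  set c := (μ univ ^ p.toReal⁻¹).toReal with hc
  have hc0 : 0 ≤ c := ENNReal.toReal_nonneg
  -- The `+ 1` allows `c = 0` and gives `η ≤ δ`; the same device recurs below.
  refine ⟨δ / (c + 1), by positivity, div_le_self hδ.le (by linarith), fun f hf => ?_⟩
  refine (eLpNorm_le_of_ae_bound hf).trans ?_
  rw [← ENNReal.ofReal_toReal hfin, ← ENNReal.ofReal_mul hc0]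
  refine ENNReal.ofReal_le_ofReal ?_
  rw [mul_div_assoc', div_le_iff₀ (by positivity)]
  nlinarith

theorem norm_toLp_le_of_forall_abs_le {n : ℕ} {v : Vec n} {η : ℝ}
    (h : ∀ i, |v i| ≤ η / (Real.sqrt n + 1)) (hη : 0 ≤ η) : ‖v‖ ≤ η := by
  have hs := Real.sqrt_nonneg n
  have hq : 0 ≤ η / (Real.sqrt n + 1) := by positivity
  rw [EuclideanSpace.norm_eq]
  calc Real.sqrt (∑ i, ‖v i‖ ^ 2) ≤ Real.sqrt (∑ _i : Fin n, (η / (Real.sqrt n + 1)) ^ 2) :=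
        Real.sqrt_le_sqrt (Finset.sum_le_sum fun i _ => pow_le_pow_left₀ (norm_nonneg _) (h i) 2)
    _ = Real.sqrt n * (η / (Real.sqrt n + 1)) := by
        rw [Finset.sum_const, Finset.card_univ, Fintype.card_fin, nsmul_eq_mul,
          Real.sqrt_mul (Nat.cast_nonneg n), Real.sqrt_sq hq]
    _ ≤ η := by
        rw [mul_div_assoc', div_le_iff₀ (by positivity)]
        nlinarith

/-! ### Approximation of the control and of the value function -/

/-- A control in `L^p` is approximated in `L^p` by networks that depend on time only. -/
theorem exists_controlNet_approx {nx nu : ℕ} {a b : ℝ} {p : ENNReal} (hp1 : 1 ≤ p) (hp : p ≠ ⊤)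
    {u : ℝ → Vec nu} (hu : MemLp u p (volume.restrict (Icc a b))) {δ : ℝ} (hδ : 0 < δ) :
    ∃ Φ ∈ NN relu (nx + 1) nu (nx + 1 + nu + 1), ∃ φ : ℝ → Vec nu, Continuous φ ∧
      (∀ (y : Vec nx) t, evalAt Φ y t = φ t) ∧
      eLpNorm (fun t => u t - φ t) p (volume.restrict (Icc a b)) ≤ ENNReal.ofReal δ := by
  obtain ⟨g, hg, hgm⟩ := hu.exists_boundedContinuous_eLpNorm_sub_le hp
    (ε := ENNReal.ofReal (δ / 2)) (by simpa using hδ)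
  obtain ⟨η, hη, -, hη'⟩ := exists_pos_forall_eLpNorm_le (volume.restrict (Icc a b)) (Vec nu) p
    (half_pos hδ)
  have hs := Real.sqrt_nonneg nu
  have hK : IsCompact ((fun (t : ℝ) (_ : Fin 1) => t) '' Icc a b) :=
    isCompact_Icc.image (by fun_prop)
  -- The network is built with time as its only input, at the width prescribed for `nx + 1` inputs.
  obtain ⟨Φ, hΦ, hΦg⟩ := exists_NN_approx (d := 1) (m := nu) (k := nx + 1 + nu + 1) (by omega) hK
    (G := fun z i => g (z 0) i) (by fun_prop) (δ := η / (Real.sqrt nu + 1)) (by positivity)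
  have hΦc : Continuous fun t : ℝ => (WithLp.toLp 2 (Φ fun _ => t) : Vec nu) :=
    (PiLp.continuous_toLp 2 _).comp ((NN.continuous continuous_relu hΦ).comp (by fun_prop))
  refine ⟨_, NN.comp_mulVec (Matrix.of fun _ => Pi.single (Fin.last nx) 1) hΦ,
    fun t => WithLp.toLp 2 (Φ fun _ => t), hΦc, fun y t => ?_, ?_⟩
  · rw [evalAt]
    congr 2
    funext i
    simp [Matrix.mulVec]
  · have h1 : eLpNorm (fun t => g t - WithLp.toLp 2 (Φ fun _ => t)) p (volume.restrict (Icc a b)) ≤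
        ENNReal.ofReal (δ / 2) := by
      refine hη' _ ((ae_restrict_mem measurableSet_Icc).mono fun t ht => ?_)
      exact norm_toLp_le_of_forall_abs_le (fun i => hΦg _ ⟨t, ht, rfl⟩ i) hη.le
    have h2 := eLpNorm_add_le (hu.1.sub hgm.1)
      (hgm.1.sub hΦc.aestronglyMeasurable) hp1
    rw [sub_add_sub_cancel] at h2
    refine h2.trans ((add_le_add hg h1).trans ?_)
    rw [← ENNReal.ofReal_add (by positivity) (by positivity), add_halves]

/-- A jointly continuous function of state and time is approximated uniformly by networks. -/
theorem exists_valueNet_approx_of_continuousOn {nx : ℕ} {R a b : ℝ} {G : Vec nx × ℝ → ℝ}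
    (hG : ContinuousOn G (Metric.closedBall 0 R ×ˢ Icc a b)) {η : ℝ} (hη : 0 < η) :
    ∃ Ψ ∈ NN relu (nx + 1) 1 (nx + 1 + 1 + 1), ∀ t ∈ Icc a b, ∀ y : Vec nx, ‖y‖ ≤ R →
      |G (y, t) - valueNet Ψ y t| ≤ η := by
  let enc : Vec nx × ℝ → Fin (nx + 1) → ℝ :=
    fun q => Fin.snoc (α := fun _ => ℝ) (fun i => q.1 i) q.2
  let dec : (Fin (nx + 1) → ℝ) → Vec nx × ℝ :=
    fun z => (WithLp.toLp 2 fun i => z i.castSucc, z (Fin.last nx))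
  have henc : Continuous enc := by
    refine continuous_pi fun i => ?_
    refine Fin.lastCases ?_ (fun j => ?_) i
    · simpa [enc] using continuous_snd
    · simp only [enc, Fin.snoc_castSucc]
      fun_prop
  have hdec : Continuous dec := by
    refine ((PiLp.continuous_toLp 2 _).comp ?_).prodMk ?_ <;> fun_prop
  have hde : ∀ q, dec (enc q) = q := fun q => by simp [enc, dec]
  have hK : IsCompact (enc '' (Metric.closedBall (0 : Vec nx) R ×ˢ Icc a b)) :=
    ((isCompact_closedBall _ _).prod isCompact_Icc).image henc
  obtain ⟨Ψ, hΨ, h⟩ := exists_NN_approx (m := 1) (k := nx + 1 + 1 + 1) (by omega) hK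
    (G := fun z _ => G (dec z)) (continuousOn_pi.2 fun _ => hG.comp hdec.continuousOn (by
      rintro _ ⟨q, hq, rfl⟩
      rwa [hde])) hη
  refine ⟨Ψ, hΨ, fun t ht y hy => ?_⟩
  have := h _ ⟨(y, t), ⟨by simpa using hy, ht⟩, rfl⟩ 0
  rwa [hde] at this

/-- A function that is Lipschitz in the state and measurable in time is approximated by networks,
in `L^p` in time and uniformly in the state, and uniformly if it is continuous in time. -/
theorem exists_valueNet_approx {nx : ℕ} {V : Vec nx → ℝ → ℝ} {a b γ : ℝ} (hab : a ≤ b)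
    (hγ : 0 ≤ γ) (hVLip : ∀ t ∈ Icc a b, ∀ x y : Vec nx, |V x t - V y t| ≤ γ * ‖x - y‖)
    (hmeas : ∀ y, Measurable fun t => V y (projIcc a b hab t))
    (hbd : ∃ B, ∀ t ∈ Icc a b, |V 0 t| ≤ B) {p : ENNReal} (hp1 : 1 ≤ p) (hp : p ≠ ⊤)
    {R : ℝ} (hR : 0 ≤ R) {δ : ℝ} (hδ : 0 < δ) :
    ∃ Ψ ∈ NN relu (nx + 1) 1 (nx + 1 + 1 + 1), ∃ h : ℝ → ℝ, StronglyMeasurable h ∧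
      eLpNorm h p (volume.restrict (Icc a b)) ≤ ENNReal.ofReal δ ∧
      (∀ t ∈ Icc a b, ∀ y, ‖y‖ ≤ R → |V y t - valueNet Ψ y t| ≤ h t) ∧
      ((∀ y, ContinuousOn (V y) (Icc a b)) → ∀ t ∈ Icc a b, h t ≤ δ) := by
  -- If `V` is continuous in time it is jointly continuous, and one uniform approximation serves all
  -- claims with constant `h`. Otherwise the last claim is vacuous.
  by_cases hVc : ∀ y, ContinuousOn (V y) (Icc a b)
  · obtain ⟨η, hη, hηδ, hη'⟩ := exists_pos_forall_eLpNorm_le (volume.restrict (Icc a b)) ℝ p hδ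
    have hjoint : ContinuousOn (fun q : Vec nx × ℝ => V q.1 q.2)
        (Metric.closedBall 0 R ×ˢ Icc a b) :=
      continuousOn_prod_of_continuousOn_lipschitzOnWith _ γ.toNNReal (fun y _ => hVc y)
        (fun t ht => LipschitzOnWith.of_dist_le_mul fun y _ z _ => by
          rw [Real.dist_eq, dist_eq_norm, Real.coe_toNNReal γ hγ]
          exact hVLip t ht y z)
    obtain ⟨Ψ, hΨ, h⟩ := exists_valueNet_approx_of_continuousOn hjoint hη
    exact ⟨Ψ, hΨ, fun _ => η, stronglyMeasurable_const,
      hη' _ (Filter.Eventually.of_forall fun _ => by simp [abs_of_pos hη]), h,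
      fun _ _ _ => hηδ⟩
  obtain ⟨η, hη, -, hη'⟩ := exists_pos_forall_eLpNorm_le (volume.restrict (Icc a b)) ℝ p
    (half_pos hδ)
  -- Time slices of `V` become points of `C(Bl, ℝ)` with the supremum norm, so approximating in
  -- `L^p` of this space is uniform in the state.
  let Bl : Set (Vec nx) := Metric.closedBall 0 R
  have : CompactSpace Bl := isCompact_iff_compactSpace.1 (isCompact_closedBall _ _)
  have : Nonempty Bl := ⟨⟨0, by simpa [Bl] using hR⟩⟩
  let mC : MeasurableSpace C(Bl, ℝ) := borel _
  have : BorelSpace C(Bl, ℝ) := ⟨rfl⟩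
  let v : ℝ → C(Bl, ℝ) := fun t => ⟨fun y => V y (projIcc a b hab t),
    (LipschitzWith.of_dist_le_mul (K := γ.toNNReal) fun y z => by
      rw [Real.dist_eq, Subtype.dist_eq, dist_eq_norm, Real.coe_toNNReal γ hγ]
      exact hVLip _ (projIcc a b hab t).2 y z).continuous⟩
  have hv : ∀ t ∈ Icc a b, ∀ y : Bl, v t y = V y t := fun t ht y => by
    simp only [v, ContinuousMap.coe_mk, projIcc_of_mem hab ht]
  let ev : C(Bl, ℝ) → ℕ → ℝ := fun φ n => φ (TopologicalSpace.denseSeq Bl n)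
  -- Evaluation on a countable dense set is a continuous injection of Polish spaces, hence a
  -- measurable embedding (Lusin–Souslin). Measurability of `v` thus reduces to that of `V y` for
  -- fixed `y`.
  have hev : MeasurableEmbedding ev := by
    refine Continuous.measurableEmbedding
      (continuous_pi fun n => continuous_eval_const _) fun φ χ h => ?_
    refine ContinuousMap.ext fun y => ?_
    exact congrFun ((TopologicalSpace.denseRange_denseSeq Bl).equalizer φ.continuous χ.continuous
      h) y
  have hvm : Measurable v := hev.measurable_comp_iff.1 (measurable_pi_iff.2 fun n => hmeas _)
  obtain ⟨B, hB⟩ := hbd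
  have hvL : MemLp v p (volume.restrict (Icc a b)) := by
    refine MemLp.of_bound hvm.aestronglyMeasurable (B + γ * R)
      ((ae_restrict_mem measurableSet_Icc).mono fun t ht => ?_)
    have hB0 : 0 ≤ B := (abs_nonneg _).trans (hB t ht)
    refine (ContinuousMap.norm_le _ (by positivity)).2 fun y => ?_
    rw [hv t ht y, Real.norm_eq_abs]
    have h1 := hVLip t ht y 0
    have h2 : ‖(y : Vec nx) - 0‖ ≤ R := by
      rw [sub_zero]
      exact mem_closedBall_zero_iff.1 y.2
    have h3 := mul_le_mul_of_nonneg_left h2 hγ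
    have h4 := abs_sub_abs_le_abs_sub (V y t) (V 0 t)
    linarith [hB t ht]
  obtain ⟨g, hg, -⟩ := hvL.exists_boundedContinuous_eLpNorm_sub_le hp
    (ε := ENNReal.ofReal (δ / 2)) (by simpa using hδ)
  classical
  let G : Vec nx × ℝ → ℝ := fun q => if hq : q.1 ∈ Bl then g q.2 ⟨q.1, hq⟩ else 0
  have hGc : ContinuousOn G (Metric.closedBall 0 R ×ˢ Icc a b) := by
    rw [continuousOn_iff_continuous_domRestrict]
    have h1 : Continuous fun q : (Metric.closedBall (0 : Vec nx) R ×ˢ Icc a b : Set _) =>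
        g q.1.2 (⟨q.1.1, q.2.1⟩ : Bl) := by fun_prop
    refine h1.congr fun q => ?_
    simp only [domRestrict_apply, G]
    rw [dif_pos q.2.1]
  obtain ⟨Ψ, hΨ, h⟩ := exists_valueNet_approx_of_continuousOn hGc hη
  have hm : StronglyMeasurable fun t => ‖v t - g t‖ :=
    (hvm.stronglyMeasurable.sub g.continuous.stronglyMeasurable).norm
  refine ⟨Ψ, hΨ, fun t => ‖v t - g t‖ + η, hm.add stronglyMeasurable_const, ?_,
    fun t ht y hy => ?_, fun hc => absurd hc hVc⟩
  · refine (eLpNorm_add_le (f := fun t => ‖v t - g t‖) (g := fun _ => η) hm.aestronglyMeasurable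
      aestronglyMeasurable_const hp1).trans ?_
    rw [← add_halves δ, ENNReal.ofReal_add (by positivity) (by positivity)]
    refine add_le_add ?_ (hη' _ (Filter.Eventually.of_forall fun _ => by simp [abs_of_pos hη]))
    rw [eLpNorm_norm]
    exact hg
  · have hy' : y ∈ Bl := by simpa [Bl] using hy
    have h1 := h t ht y hy
    have h2 := (v t - g t).norm_coe_le_norm ⟨y, hy'⟩
    rw [ContinuousMap.sub_apply, hv t ht, Real.norm_eq_abs] at h2
    simp only [G, dif_pos hy'] at h1
    exact (abs_sub_le _ _ _).trans (add_le_add h2 h1)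

/-- The second projection pushes the product measure to `μ univ • ν`. -/
theorem eLpNorm_comp_snd_prod {α β : Type*} [MeasurableSpace α] [MeasurableSpace β]
    {μ : Measure α} {ν : Measure β} [SFinite ν] {h : β → ℝ} (hh : StronglyMeasurable h)
    {p : ENNReal} (hp : p ≠ ⊤) :
    eLpNorm (fun z : α × β => h z.2) p (μ.prod ν) = μ univ ^ (1 / p).toReal * eLpNorm h p ν := by
  have h1 := eLpNorm_map_measure (μ := μ.prod ν) (p := p) (f := Prod.snd) (g := h)
    hh.aestronglyMeasurable measurable_snd.aemeasurable
  rw [Measure.map_snd_prod, eLpNorm_smul_measure_of_ne_top hp, smul_eq_mul] at h1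
  exact h1.symm

theorem eLpNorm_mul_exp_eq_betaNorm {M tf p : ℝ} (hM : 0 ≤ M) (htf : 0 ≤ tf) (hp : 1 ≤ p) :
    eLpNorm (fun t => M * Real.exp (M * t)) (ENNReal.ofReal p) (volume.restrict (Icc 0 tf)) =
      ENNReal.ofReal (betaNorm M tf p) := by
  have hp0 : 0 < p := by linarith
  have hc : Continuous fun t : ℝ => M * Real.exp (M * t) := by fun_prop
  obtain ⟨B, hB⟩ := isCompact_Icc.exists_bound_of_continuousOn
    (hc.continuousOn (s := Icc 0 tf))
  have hm : MemLp (fun t => M * Real.exp (M * t)) (ENNReal.ofReal p)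
      (volume.restrict (Icc 0 tf)) :=
    MemLp.of_bound hc.aestronglyMeasurable B ((ae_restrict_mem measurableSet_Icc).mono hB)
  rw [hm.eLpNorm_eq_integral_rpow_norm (by simpa using hp0) ENNReal.ofReal_ne_top,
    ENNReal.toReal_ofReal hp0.le, betaNorm, one_div, intervalIntegral.integral_of_le htf,
    integral_Icc_eq_integral_Ioc]
  congr 3
  funext t
  rw [Real.norm_of_nonneg (by positivity)]

theorem integral_norm_le_of_eLpNorm_one_le {E : Type*} [NormedAddCommGroup E] {w : ℝ → E}
    {b ε : ℝ} (hw : IntegrableOn w (Icc 0 b)) (hε : 0 ≤ ε)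
    (h : eLpNorm w 1 (volume.restrict (Icc 0 b)) ≤ ENNReal.ofReal ε) {t : ℝ} (ht : t ∈ Icc 0 b) :
    ∫ s in (0 : ℝ)..t, ‖w s‖ ≤ ε := by
  rw [eLpNorm_one_eq_lintegral_enorm, ← ofReal_integral_norm_eq_lintegral_enorm hw,
    ENNReal.ofReal_le_ofReal_iff hε] at h
  refine le_trans ?_ h
  rw [intervalIntegral.integral_of_le ht.1]
  exact setIntegral_mono_set hw.norm (Filter.Eventually.of_forall fun _ => norm_nonneg _)
    (Filter.Eventually.of_forall fun s hs => ⟨hs.1.le, hs.2.trans ht.2⟩)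

theorem continuous_evalAt {nx m : ℕ} {Φ : (Fin (nx + 1) → ℝ) → (Fin m → ℝ)} (hΦ : Continuous Φ) :
    Continuous fun q : Vec nx × ℝ => evalAt Φ q.1 q.2 := by
  refine (PiLp.continuous_toLp 2 _).comp (hΦ.comp (continuous_pi fun i => ?_))
  refine Fin.lastCases ?_ (fun j => ?_) i
  · simpa using continuous_snd
  · simp only [Fin.snoc_castSucc]
    fun_prop

/-! ### The error bound and the existence of accurate networks -/

theorem theorem4 {nx nu m : ℕ}
    -- the switched optimal control problem
    (R : Fin m → Set (Vec nx × Vec nu))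
    (f : Fin m → Vec nx → Vec nu → ℝ → Vec nx) (L : Fin m → Vec nx → Vec nu → ℝ)
    (ψ : Vec nx → ℝ) (tf : ℝ) (htf : 0 < tf)
    -- the dynamics are Lipschitz in state and control, and continuous in time
    (M : ℝ) (hM : 0 ≤ M)
    (hfLip : ∀ t ∈ Icc 0 tf, ∀ x y : Vec nx, ∀ u v : Vec nu,
      ‖switchedField R f x u t - switchedField R f y v t‖ ≤ M * (‖x - y‖ + ‖u - v‖))
    (hfCont : ∀ x u, ContinuousOn (fun t => switchedField R f x u t) (Icc 0 tf))
    -- the stage cost is Borel measurable and bounded on bounded sets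
    (hLMeas : Measurable (fun z : Vec nx × Vec nu => switched R L z.1 z.2))
    (hLBdd : ∀ r : ℝ, ∃ B : ℝ, ∀ x u, ‖x‖ ≤ r → ‖u‖ ≤ r → |switched R L x u| ≤ B)
    -- the value function is globally Lipschitz in the state
    (V : Vec nx → ℝ → ℝ)
    (hV : IsValueFunction (switchedField R f) (switched R L) ψ tf V)
    (γ : ℝ) (hγ : 0 ≤ γ)
    (hVLip : ∀ t ∈ Icc 0 tf, ∀ x y : Vec nx, |V x t - V y t| ≤ γ * ‖x - y‖)
    -- a control in `L^p` and its state trajectory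
    (p : ℝ) (hp : 1 ≤ p) (x₀ : Vec nx) (x : ℝ → Vec nx) (u : ℝ → Vec nu)
    (hu : MemLp u (ENNReal.ofReal p) (volume.restrict (Icc 0 tf)))
    (hx : IsTrajectory (switchedField R f) 0 tf x₀ x u) :
    -- error bound for all networks
    (∀ Φ ∈ NN relu (nx + 1) nu (nx + 1 + nu + 1), ∀ Ψ ∈ NN relu (nx + 1) 1 (nx + 1 + 1 + 1),
      ∀ x' : ℝ → Vec nx,
      IsTrajectory (switchedField R f) 0 tf x₀ x' (fun t => evalAt Φ (x' t) t) →
      (∀ t ∈ Icc 0 tf,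
        ‖x t - x' t‖ ≤ M * Real.exp (M * t) * ∫ s in (0 : ℝ)..t, ‖u s - evalAt Φ (x' s) s‖) ∧
      (∀ t ∈ Icc 0 tf,
        |V (x t) t - valueNet Ψ (x' t) t| ≤
          γ * (M * Real.exp (M * t)) * (∫ s in (0 : ℝ)..t, ‖u s - evalAt Φ (x' s) s‖) +
            |V (x' t) t - valueNet Ψ (x' t) t|) ∧
      (∀ ε : ℝ, 0 ≤ ε →
        eLpNorm (fun t => u t - evalAt Φ (x' t) t) 1
          (volume.restrict (Icc 0 tf)) ≤ ENNReal.ofReal ε →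
        eLpNorm (fun t => V (x' t) t - valueNet Ψ (x' t) t) (ENNReal.ofReal p)
          (volume.restrict (Icc 0 tf)) ≤ ENNReal.ofReal ε →
        eLpNorm (fun t => V (x t) t - valueNet Ψ (x' t) t) (ENNReal.ofReal p)
          (volume.restrict (Icc 0 tf)) ≤ ENNReal.ofReal ((γ * betaNorm M tf p + 1) * ε))) ∧
    -- existence of approximating networks of arbitrary accuracy
    (∀ ε : ℝ, 0 < ε → ∀ r : ℝ,
      ∃ Φ ∈ NN relu (nx + 1) nu (nx + 1 + nu + 1), ∃ Ψ ∈ NN relu (nx + 1) 1 (nx + 1 + 1 + 1),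
        -- the second network approximates the value function on the ball of radius `r`
        eLpNorm (fun z : Vec nx × ℝ => V z.1 z.2 - valueNet Ψ z.1 z.2) (ENNReal.ofReal p)
          (volume.restrict (Metric.closedBall 0 r ×ˢ Icc 0 tf)) ≤ ENNReal.ofReal ε ∧
        -- the first network drives the system
        (∃ x' : ℝ → Vec nx,
          IsTrajectory (switchedField R f) 0 tf x₀ x' (fun t => evalAt Φ (x' t) t)) ∧
        (∀ x' : ℝ → Vec nx,
          IsTrajectory (switchedField R f) 0 tf x₀ x' (fun t => evalAt Φ (x' t) t) →
          eLpNorm (fun t => u t - evalAt Φ (x' t) t) 1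
            (volume.restrict (Icc 0 tf)) ≤ ENNReal.ofReal ε ∧
          eLpNorm (fun t => u t - evalAt Φ (x' t) t) (ENNReal.ofReal p)
            (volume.restrict (Icc 0 tf)) ≤ ENNReal.ofReal ε ∧
          eLpNorm (fun t => V (x' t) t - valueNet Ψ (x' t) t) (ENNReal.ofReal p)
            (volume.restrict (Icc 0 tf)) ≤ ENNReal.ofReal ε ∧
          eLpNorm (fun t => V (x t) t - valueNet Ψ (x' t) t) (ENNReal.ofReal p)
            (volume.restrict (Icc 0 tf)) ≤ ENNReal.ofReal ((γ * betaNorm M tf p + 1) * ε)) ∧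
        -- pointwise bounds, when the value function is continuous in time
        ((∀ y, ContinuousOn (V y) (Icc 0 tf)) →
          (∀ t ∈ Icc 0 tf, ∀ y : Vec nx, ‖y‖ ≤ r → |V y t - valueNet Ψ y t| ≤ ε) ∧
          (∀ x' : ℝ → Vec nx,
            IsTrajectory (switchedField R f) 0 tf x₀ x' (fun t => evalAt Φ (x' t) t) →
            ∀ t ∈ Icc 0 tf,
              |V (x t) t - valueNet Ψ (x' t) t| ≤ (γ * (M * Real.exp (M * t)) + 1) * ε))) := by

  set F := switchedField R f with hF
  set μ := volume.restrict (Icc 0 tf) with hμ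
  have hp0 : 0 < p := by linarith
  have hp1 : (1 : ENNReal) ≤ ENNReal.ofReal p := by simpa using ENNReal.ofReal_le_ofReal hp
  have hui : IntegrableOn u (Icc 0 tf) := hu.integrable hp1
  have hβ : ∀ t, 0 ≤ M * Real.exp (M * t) := fun t => by positivity
  have hB0 : 0 ≤ betaNorm M tf p :=
    Real.rpow_nonneg (intervalIntegral.integral_nonneg htf.le
      fun t _ => Real.rpow_nonneg (hβ t) p) _
  have hsub : ∀ Φ ∈ NN relu (nx + 1) nu (nx + 1 + nu + 1), ∀ x' : ℝ → Vec nx,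
      IsTrajectory F 0 tf x₀ x' (fun t => evalAt Φ (x' t) t) →
      IntegrableOn (fun t => u t - evalAt Φ (x' t) t) (Icc 0 tf) := fun Φ hΦ x' hx' => by
    have h1 := ((continuous_evalAt (NN.continuous continuous_relu hΦ)).comp_continuousOn
      (hx'.continuousOn.prodMk continuousOn_id)).integrableOn_Icc (μ := volume)
    exact hui.sub h1
  have hstate : ∀ Φ ∈ NN relu (nx + 1) nu (nx + 1 + nu + 1), ∀ x' : ℝ → Vec nx,
      IsTrajectory F 0 tf x₀ x' (fun t => evalAt Φ (x' t) t) → ∀ t ∈ Icc 0 tf,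
      ‖x t - x' t‖ ≤ M * Real.exp (M * t) * ∫ s in (0 : ℝ)..t, ‖u s - evalAt Φ (x' s) s‖ :=
    fun Φ hΦ x' hx' t ht => hx.norm_sub_le hM hfLip hx'
      ((intervalIntegrable_iff_integrableOn_Icc_of_le htf.le).2 (hsub Φ hΦ x' hx')) ht
  have hvalue : ∀ Φ ∈ NN relu (nx + 1) nu (nx + 1 + nu + 1),
      ∀ Ψ : (Fin (nx + 1) → ℝ) → (Fin 1 → ℝ), ∀ x' : ℝ → Vec nx,
      IsTrajectory F 0 tf x₀ x' (fun t => evalAt Φ (x' t) t) → ∀ t ∈ Icc 0 tf,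
      |V (x t) t - valueNet Ψ (x' t) t| ≤
        γ * (M * Real.exp (M * t)) * (∫ s in (0 : ℝ)..t, ‖u s - evalAt Φ (x' s) s‖) +
          |V (x' t) t - valueNet Ψ (x' t) t| := fun Φ hΦ Ψ x' hx' t ht => by
    have h1 := mul_le_mul_of_nonneg_left (hstate Φ hΦ x' hx' t ht) hγ
    have h2 := hVLip t ht (x t) (x' t)
    have h3 := abs_sub_le (V (x t) t) (V (x' t) t) (valueNet Ψ (x' t) t)
    rw [← mul_assoc] at h1
    linarith
  have herror : ∀ Φ ∈ NN relu (nx + 1) nu (nx + 1 + nu + 1),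
      ∀ Ψ : (Fin (nx + 1) → ℝ) → (Fin 1 → ℝ), ∀ x' : ℝ → Vec nx,
      IsTrajectory F 0 tf x₀ x' (fun t => evalAt Φ (x' t) t) → ∀ ε : ℝ, 0 ≤ ε →
      eLpNorm (fun t => u t - evalAt Φ (x' t) t) 1 μ ≤ ENNReal.ofReal ε →
      eLpNorm (fun t => V (x' t) t - valueNet Ψ (x' t) t) (ENNReal.ofReal p) μ ≤
        ENNReal.ofReal ε →
      eLpNorm (fun t => V (x t) t - valueNet Ψ (x' t) t) (ENNReal.ofReal p) μ ≤
        ENNReal.ofReal ((γ * betaNorm M tf p + 1) * ε) := fun Φ hΦ Ψ x' hx' ε hε h1 h2 => by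
    have h3 : eLpNorm (fun t => (γ * ε) * (M * Real.exp (M * t))) (ENNReal.ofReal p) μ =
        ENNReal.ofReal (γ * ε * betaNorm M tf p) := by
      have := eLpNorm_const_smul (γ * ε) (fun t => M * Real.exp (M * t)) (ENNReal.ofReal p) μ
      rw [eLpNorm_mul_exp_eq_betaNorm hM htf.le hp, Real.enorm_of_nonneg (by positivity),
        ← ENNReal.ofReal_mul (by positivity)] at this
      exact this
    have h4 : eLpNorm (fun t => V (x t) t - valueNet Ψ (x' t) t) (ENNReal.ofReal p) μ ≤
        eLpNorm (fun t => (γ * ε) * (M * Real.exp (M * t))) (ENNReal.ofReal p) μ +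
        eLpNorm (fun t => V (x' t) t - valueNet Ψ (x' t) t) (ENNReal.ofReal p) μ := by
      refine eLpNorm_le_add_of_norm_le
        (by fun_prop : Continuous fun t => (γ * ε) * (M * Real.exp (M * t))).aestronglyMeasurable
        hp ((ae_restrict_mem measurableSet_Icc).mono fun t ht => ?_)
      have h5 := hvalue Φ hΦ Ψ x' hx' t ht
      have h6 := mul_le_mul_of_nonneg_left
        (integral_norm_le_of_eLpNorm_one_le (hsub Φ hΦ x' hx') hε h1 ht)
        (mul_nonneg hγ (hβ t))
      simp only [Real.norm_eq_abs]
      rw [abs_of_nonneg (mul_nonneg (mul_nonneg hγ hε) (hβ t))]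
      linarith
    refine h4.trans ?_
    rw [h3, show (γ * betaNorm M tf p + 1) * ε = γ * ε * betaNorm M tf p + ε by ring,
      ENNReal.ofReal_add (by positivity) hε]
    gcongr
  refine ⟨fun Φ hΦ Ψ _ x' hx' => ⟨hstate Φ hΦ x' hx', hvalue Φ hΦ Ψ x' hx',
    herror Φ hΦ Ψ x' hx'⟩, fun ε hε r => ?_⟩
  -- the control network
  set c := (μ univ ^ (1 / (1 : ENNReal).toReal - 1 / (ENNReal.ofReal p).toReal)).toReal with hc
  have hc0 : 0 ≤ c := ENNReal.toReal_nonneg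
  have hcfin : μ univ ^ (1 / (1 : ENNReal).toReal - 1 / (ENNReal.ofReal p).toReal) ≠ ⊤ := by
    refine ENNReal.rpow_ne_top_of_nonneg ?_ (measure_ne_top _ _)
    rw [ENNReal.toReal_ofReal hp0.le, ENNReal.toReal_one, sub_nonneg, div_one,
      div_le_one hp0]
    exact hp
  -- Since `c` bounds the `L^1` norm by the `L^p` norm, accuracy `ε / (c + 1)` in `L^p` gives `ε` in
  -- both.
  obtain ⟨Φ, hΦ, φ, hφc, hφ, hφu⟩ := exists_controlNet_approx (nx := nx) hp1 ENNReal.ofReal_ne_top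
    hu (δ := ε / (c + 1)) (by positivity)
  have hφp : eLpNorm (fun t => u t - φ t) (ENNReal.ofReal p) μ ≤ ENNReal.ofReal ε :=
    hφu.trans (ENNReal.ofReal_le_ofReal (div_le_self hε.le (by linarith)))
  have hφ1 : eLpNorm (fun t => u t - φ t) 1 μ ≤ ENNReal.ofReal ε := by
    refine (eLpNorm_le_eLpNorm_mul_rpow_measure_univ hp1
      (hu.1.sub hφc.aestronglyMeasurable)).trans ?_
    rw [← ENNReal.ofReal_toReal hcfin]
    refine (mul_le_mul_left hφu _).trans ?_
    rw [← ENNReal.ofReal_mul (by positivity)]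
    refine ENNReal.ofReal_le_ofReal ?_
    rw [div_mul_eq_mul_div, div_le_iff₀ (by positivity)]
    nlinarith
  -- No trajectory hypothesis is needed: `Φ` does not see the state.
  have hL1 : ∀ x' : ℝ → Vec nx,
      eLpNorm (fun t => u t - evalAt Φ (x' t) t) 1 μ ≤ ENNReal.ofReal ε := fun x' => by
    simpa only [hφ] using hφ1
  have hint : ∀ x' : ℝ → Vec nx,
      IsTrajectory F 0 tf x₀ x' (fun t => evalAt Φ (x' t) t) → ∀ t ∈ Icc 0 tf,
      ∫ s in (0 : ℝ)..t, ‖u s - evalAt Φ (x' s) s‖ ≤ ε := fun x' hx' t ht =>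
    integral_norm_le_of_eLpNorm_one_le (hsub Φ hΦ x' hx') hε.le (hL1 x') ht
  -- a ball that contains the trajectories
  obtain ⟨ρ, hρ⟩ := isCompact_Icc.exists_bound_of_continuousOn hx.continuousOn
  have hρ0 : 0 ≤ ρ := (norm_nonneg _).trans (hρ 0 ⟨le_rfl, htf.le⟩)
  -- The radius adds to the bound on `x` the largest state error, attained by the factor at `t =
  -- tf`. It does not involve `Ψ`, which can therefore be fitted on this ball.
  set ρ' := ρ + M * Real.exp (M * tf) * ε with hρ'
  have hρ'0 : 0 ≤ ρ' := by positivity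
  have hball : ∀ x' : ℝ → Vec nx,
      IsTrajectory F 0 tf x₀ x' (fun t => evalAt Φ (x' t) t) → ∀ t ∈ Icc 0 tf,
      ‖x' t‖ ≤ max r ρ' := fun x' hx' t ht => by
    refine le_trans ?_ (le_max_right _ _)
    have h1 := hstate Φ hΦ x' hx' t ht
    have h2 := mul_le_mul_of_nonneg_left (hint x' hx' t ht) (hβ t)
    have h3 : M * Real.exp (M * t) * ε ≤ M * Real.exp (M * tf) * ε := by
      have := ht.2
      gcongr
    have h4 := norm_le_norm_sub_add (x' t) (x t)
    rw [norm_sub_rev] at h4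
    linarith [hρ t ht]
  -- the value network
  have hVmono : ∀ y, ∃ C : ℝ, ∀ t ∈ Icc 0 tf, ∀ t' ∈ Icc 0 tf, t ≤ t' →
      V y t ≤ V y t' + C * (t' - t) :=
    hV.exists_le_add_mul_sub htf.le hM hfLip hfCont hLMeas hLBdd hγ hVLip
  set μB := volume.restrict (Metric.closedBall (0 : Vec nx) r) with hμB
  have hμBfin : μB univ ^ (1 / ENNReal.ofReal p).toReal ≠ ⊤ := by
    refine ENNReal.rpow_ne_top_of_nonneg ENNReal.toReal_nonneg ?_
    rw [hμB, Measure.restrict_apply_univ]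
    exact measure_closedBall_lt_top.ne
  -- This factor converts the time norm of `h` into a norm over the ball times `[0, tf]`.
  set κ := (μB univ ^ (1 / ENNReal.ofReal p).toReal).toReal with hκ
  have hκ0 : 0 ≤ κ := ENNReal.toReal_nonneg
  have hδε : ε / (κ + 1) ≤ ε := div_le_self hε.le (by linarith)
  obtain ⟨Ψ, hΨ, h, hhm, hhp, hVh, hhc⟩ := exists_valueNet_approx htf.le hγ hVLip
    (fun y => measurable_comp_projIcc_of_le_add htf.le (hVmono y).choose_spec)
    (exists_abs_le_of_le_add htf.le (hVmono 0).choose_spec) hp1 ENNReal.ofReal_ne_top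
    (hρ'0.trans (le_max_right r ρ')) (δ := ε / (κ + 1)) (by positivity)
  have hVx' : ∀ x' : ℝ → Vec nx,
      IsTrajectory F 0 tf x₀ x' (fun t => evalAt Φ (x' t) t) →
      eLpNorm (fun t => V (x' t) t - valueNet Ψ (x' t) t) (ENNReal.ofReal p) μ ≤
        ENNReal.ofReal ε := fun x' hx' =>
    (eLpNorm_mono_ae_real ((ae_restrict_mem measurableSet_Icc).mono fun t ht =>
      hVh t ht _ (hball x' hx' t ht))).trans (hhp.trans (ENNReal.ofReal_le_ofReal hδε))
  refine ⟨Φ, hΦ, Ψ, hΨ, ?_, ?_, fun x' hx' => ⟨hL1 x', ?_, hVx' x' hx',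
    herror Φ hΦ Ψ x' hx' ε hε.le (hL1 x') (hVx' x' hx')⟩, fun hVc => ⟨fun t ht y hy => ?_,
    fun x' hx' t ht => ?_⟩⟩
  · have h1 : eLpNorm (fun z : Vec nx × ℝ => V z.1 z.2 - valueNet Ψ z.1 z.2) (ENNReal.ofReal p)
        (volume.restrict (Metric.closedBall 0 r ×ˢ Icc 0 tf)) ≤
        eLpNorm (fun z : Vec nx × ℝ => h z.2) (ENNReal.ofReal p)
        (volume.restrict (Metric.closedBall 0 r ×ˢ Icc 0 tf)) := by
      refine eLpNorm_mono_ae_real ((ae_restrict_mem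
        (measurableSet_closedBall.prod measurableSet_Icc)).mono fun z hz => ?_)
      exact hVh z.2 hz.2 z.1 ((mem_closedBall_zero_iff.1 hz.1).trans (le_max_left _ _))
    rw [Measure.volume_eq_prod, ← Measure.prod_restrict] at h1
    rw [Measure.volume_eq_prod, ← Measure.prod_restrict]
    refine h1.trans ?_
    rw [eLpNorm_comp_snd_prod hhm ENNReal.ofReal_ne_top, ← ENNReal.ofReal_toReal hμBfin]
    refine (mul_le_mul_right hhp _).trans ?_
    rw [← ENNReal.ofReal_mul hκ0]
    refine ENNReal.ofReal_le_ofReal ?_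
    rw [mul_div_assoc', div_le_iff₀ (by positivity)]
    nlinarith
  · obtain ⟨x', hx'⟩ := exists_isTrajectory_of_continuousOn htf.le hM hfLip hfCont
      hφc.continuousOn x₀
    exact ⟨x', by simpa only [hφ] using hx'⟩
  · simpa only [hφ] using hφp
  · exact (hVh t ht y (hy.trans (le_max_left _ _))).trans ((hhc hVc t ht).trans hδε)
  · have h1 := hvalue Φ hΦ Ψ x' hx' t ht
    have h2 := mul_le_mul_of_nonneg_left (hint x' hx' t ht) (mul_nonneg hγ (hβ t))
    have h3 := (hVh t ht _ (hball x' hx' t ht)).trans ((hhc hVc t ht).trans hδε)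
    linarith
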